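/- Fix integers $q\ge 0$, $B\ge 1$, a level $\alpha\in(0,1)$, reals $\beta,\beta^0$ and $\gamma^\star\in\mathbb R^q$. Consider a sequence of experiments whose total numbers of observations $n$ tend to infinity (the index of the sequence is suppressed; the experiments may live on different probability spaces). In each experiment there are $N$ clusters of deterministic sizes $n_1,\dots,n_N$, $n=\sum_j n_j$; cluster $j$ carries a covariate of interest $x_j\in\mathbb R^{n_j}$, nuisance covariates $Z_j\in\mathbb R^{n_j\times q}$ and an integrable response $y_j\in\mathbb R^{n_j}$ (all possibly random), and the triples $(x_j,Z_j,y_j)$, $j=1,\dots,N$, are independent. Let $x,Z,y$ be the stacked quantities. Let $W=\mathrm{diag}(W_1,\dots,W_N)$, with $W_j$ symmetric positive definite and fixed or $(x,Z)$-measurable, be the working weights, and let $\widehat W=\mathrm{diag}(\widehat W_1,\dots,\widehat W_N)$, with $\widehat W_j$ random symmetric positive definite, be the weights with which the test is computed ($\widehat W=W$ is allowed). Assume that, for all large $n$, $Z^\top \widehat W Z$ is almost surely nonsingular. For a weight matrix $A\in\{W,\widehat W\}$ put $H_A=A^{1/2}Z(Z^\top AZ)^{-1}Z^\top A^{1/2}$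 and, for $\gamma\in\mathbb R^q$, $$\zeta_j^{\gamma}(A)=\bigl[(I-H_A)A^{1/2}x\bigr]_j^\top\bigl[A^{1/2}(y-x\beta^0-Z\gamma)\bigr]_j ,$$ where $[\cdot]_j$ is the subvector of cluster $j$. Let $$\hat\gamma=(Z^\top\widehat WZ)^{-1}Z^\top\widehat W(y-x\beta^0),\qquad \hat\zeta_j=\zeta_j^{\hat\gamma}(\widehat W),\qquad \zeta_j^\star=\zeta_j^{\gamma^\star}(W).$$ Let $s_j^1=1$ for all $j$, and let $s_j^b$ ($2\le b\le B$, $1\le j\le N$) be independent Rademacher signs, independent of $(x,Z,y,\widehat W)$. The clusterwise flipped scores are $S(F_b)=n^{-1/2}\sum_{j=1}^N s_j^b\hat\zeta_j$, $b=1,\dots,B$ (so $F_1=I$), with order statistics $S_{(1)}\le\dots\le S_{(B)}$. The test of $H_0:\beta=\beta^0$ against $\beta>\beta^0$ rejects when $$S(F_1)>S_{(\lceil(1-\alpha)B\rceil)} .$$ Assume: 1. $\mathbb E(y_j\mid x_j,Z_j)=x_j\beta+Z_j\gamma^\star$ for every $j$; 2. $\max_j n_j/n\to0$; 3. for some $d>2$,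 $n^{-d/2}\sum_j\mathbb E|\zeta_j^\star|^d\to0$; 4. for some $\sigma^2>0$, $n^{-1}\sum_j\mathrm{Var}(\zeta_j^\star)\to\sigma^2$, and for every $\epsilon>0$, $n^{-1}\sum_j\mathbb E\bigl[|\zeta_j^\star|^2\mathbf 1\{|\zeta_j^\star|>\epsilon\sqrt n\}\bigr]\to0$; moreover, if the covariates are random, $n^{-1}\sum_j\mathrm{Var}(\zeta_j^\star\mid x,Z)$ is bounded away from $0$ in probability: for every $\epsilon>0$ there is $\delta>0$ such that, for all large $n$, it is smaller than $\delta$ with probability at most $\epsilon$ (for nonrandom covariates this follows from the first part); 5. there are deterministic $r_n\to\infty$ with $r_n\le\sqrt n$ and $r_n\|\hat\gamma-\gamma^\star\|=O_p(1)$; 6. $n^{-1/2}\sum_j|\hat\zeta_j-\zeta_j^\star|=o_p(1)$. Then, under $H_0$, the rejection probability satisfies $$\Pr\bigl\{S(F_1)>S_{(\lceil(1-\alpha)B\rceil)}\bigr\}\longrightarrow\frac{\lfloor\alpha B\rfloor}{B}\le\alpha\qquad(n\to\infty).$$ -/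

import Mathlib

open MeasureTheory ProbabilityTheory Filter Topology Matrix
open scoped ENNReal MatrixOrder

universe u

noncomputable section

/-! ### Clusterwise effective score (deterministic formulas) -/

/-- Index of an observation: a cluster `j` together with an occasion `i` within it. A stacked vector
`(v_1ᵀ, …, v_Nᵀ)ᵀ` is a function on `Obs size`, and its subvector `[v]_j` is `fun i => v ⟨j, i⟩`. -/
abbrev Obs {N : ℕ} (size : Fin N → ℕ) : Type := (j : Fin N) × Fin (size j)

section Score

variable {N : ℕ} {size : Fin N → ℕ} {q : ℕ}

/-- Square root of the block diagonal weight matrix `diag(W_1, …, W_N)`: the block diagonal matrix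
of the positive semidefinite square roots of the blocks. -/
def weightSqrt (W : ∀ j, Matrix (Fin (size j)) (Fin (size j)) ℝ) : Matrix (Obs size) (Obs size) ℝ :=
  Matrix.blockDiagonal' fun j => CFC.sqrt (W j)

/-- The matrix `Zᵀ W Z = ∑_j Z_jᵀ W_j Z_j`, where `W = diag(W_1, …, W_N)`. -/
def weightedGram (W : ∀ j, Matrix (Fin (size j)) (Fin (size j)) ℝ)
    (Z : Matrix (Obs size) (Fin q) ℝ) : Matrix (Fin q) (Fin q) ℝ :=
  Zᵀ * Matrix.blockDiagonal' W * Z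

/-- The generalized least-squares estimator of the nuisance parameter under `β = β₀`:
`(Zᵀ W Z)⁻¹ Zᵀ W (y - x β₀)`. -/
def gammaHat (β₀ : ℝ) (W : ∀ j, Matrix (Fin (size j)) (Fin (size j)) ℝ)
    (x : Obs size → ℝ) (Z : Matrix (Obs size) (Fin q) ℝ) (y : Obs size → ℝ) : Fin q → ℝ :=
  (weightedGram W Z)⁻¹ *ᵥ (Zᵀ *ᵥ (Matrix.blockDiagonal' W *ᵥ (y - β₀ • x)))

/-- The matrix `H = W^{1/2} Z (Zᵀ W Z)⁻¹ Zᵀ W^{1/2}`. -/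
def hatMatrix (W : ∀ j, Matrix (Fin (size j)) (Fin (size j)) ℝ)
    (Z : Matrix (Obs size) (Fin q) ℝ) : Matrix (Obs size) (Obs size) ℝ :=
  weightSqrt W * Z * (weightedGram W Z)⁻¹ * Zᵀ * weightSqrt W

/-- The mean `x β₀ + Z γ`. -/
def fittedMean (β₀ : ℝ) (x : Obs size → ℝ) (Z : Matrix (Obs size) (Fin q) ℝ)
    (γ : Fin q → ℝ) : Obs size → ℝ :=
  β₀ • x + Z *ᵥ γ

/-- Contribution of cluster `j` to the effective score, at the nuisance parameter `γ`:
`ζ_j^γ = [(I - H) W^{1/2} x]_jᵀ [W^{1/2} (y - x β₀ - Z γ)]_j`. -/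
def scoreContribution (β₀ : ℝ) (W : ∀ j, Matrix (Fin (size j)) (Fin (size j)) ℝ)
    (x : Obs size → ℝ) (Z : Matrix (Obs size) (Fin q) ℝ) (y : Obs size → ℝ)
    (γ : Fin q → ℝ) (j : Fin N) : ℝ :=
  (fun i : Fin (size j) => ((1 - hatMatrix W Z) *ᵥ (weightSqrt W *ᵥ x)) ⟨j, i⟩) ⬝ᵥ
    (fun i : Fin (size j) => (weightSqrt W *ᵥ (y - fittedMean β₀ x Z γ)) ⟨j, i⟩)

end Score

/-- The `r`-th order statistic (`r = 1, …, B`) of `v_1, …, v_B`, i.e. the `r`-th smallest value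
counted with multiplicity (and `0` if `r` is out of range). -/
def orderStat {B : ℕ} (v : Fin B → ℝ) (r : ℕ) : ℝ :=
  if h : 1 ≤ r ∧ r ≤ B then v (Tuple.sort v ⟨r - 1, by omega⟩) else 0

/-! ### The sampling experiment -/

/-- The random objects of one experiment: `N` clusters of sizes `size j`, the covariate of interest
`x`, the nuisance covariates `Z`, the response `y`, the working weights `W_j`, their data-driven
versions `Ŵ_j` used in practice (`Ŵ = W` is possible), and `B` vectors of clusterwise signs;
`sign ω b j` is the sign `s_j^b` that the `b`-th transformation gives to cluster `j`.
The conditions on these objects are stated separately. -/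
structure ClusterExperiment (q B : ℕ) where
  /-- number of clusters -/
  N : ℕ
  /-- cluster sizes -/
  size : Fin N → ℕ
  /-- underlying sample space -/
  Ω : Type u
  /-- events -/
  mΩ : MeasurableSpace Ω
  /-- underlying probability measure -/
  P : @Measure Ω mΩ
  /-- covariate of interest -/
  x : Ω → Obs size → ℝ
  /-- nuisance covariates -/
  Z : Ω → Matrix (Obs size) (Fin q) ℝ
  /-- response -/
  y : Ω → Obs size → ℝ
  /-- working weights -/
  W : Ω → ∀ j, Matrix (Fin (size j)) (Fin (size j)) ℝ
  /-- weights with which the test is computed -/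
  What : Ω → ∀ j, Matrix (Fin (size j)) (Fin (size j)) ℝ
  /-- clusterwise signs -/
  sign : Ω → Fin B → Fin N → ℝ

namespace ClusterExperiment

attribute [instance] ClusterExperiment.mΩ

variable {q B : ℕ} (E : ClusterExperiment.{u} q B)

/-- Total number of observations `n = ∑_j n_j`. -/
def total : ℕ := ∑ j, E.size j

/-- The size of the largest cluster. -/
def maxSize : ℕ := Finset.univ.sup E.size

/-- The covariates `(x_j, Z_j)` of cluster `j`. -/
def clusterCovariates (j : Fin E.N) (ω : E.Ω) :
    (Fin (E.size j) → ℝ) × (Fin (E.size j) → Fin q → ℝ) :=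
  (fun i => E.x ω ⟨j, i⟩, fun i c => E.Z ω ⟨j, i⟩ c)

/-- The data `((x_j, Z_j), y_j)` of cluster `j`. -/
def clusterData (j : Fin E.N) (ω : E.Ω) :
    ((Fin (E.size j) → ℝ) × (Fin (E.size j) → Fin q → ℝ)) × (Fin (E.size j) → ℝ) :=
  (E.clusterCovariates j ω, fun i => E.y ω ⟨j, i⟩)

/-- The σ-algebra generated by the covariates `(x_j, Z_j)` of cluster `j`. -/
abbrev clusterSigma (j : Fin E.N) : MeasurableSpace E.Ω :=
  MeasurableSpace.comap (E.clusterCovariates j) inferInstance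

/-- The σ-algebra generated by all covariates `(x, Z)`. -/
abbrev designSigma : MeasurableSpace E.Ω := ⨆ j, E.clusterSigma j

/-- Everything that the test statistic is computed from, apart from the signs. -/
def observed (ω : E.Ω) :
    (∀ j, ((Fin (E.size j) → ℝ) × (Fin (E.size j) → Fin q → ℝ)) × (Fin (E.size j) → ℝ)) ×
      (∀ j, Fin (E.size j) → Fin (E.size j) → ℝ) :=
  (fun j => E.clusterData j ω, fun j a b => E.What ω j a b)

/-- Score contribution `ζ_j^{γ⋆}` at the true nuisance parameter, with the working weights `W`. -/
def zetaStar (β₀ : ℝ) (γstar : Fin q → ℝ) (j : Fin E.N) (ω : E.Ω) : ℝ :=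
  scoreContribution β₀ (E.W ω) (E.x ω) (E.Z ω) (E.y ω) γstar j

/-- The nuisance estimator `γ̂`. -/
def gammaEst (β₀ : ℝ) (ω : E.Ω) : Fin q → ℝ :=
  gammaHat β₀ (E.What ω) (E.x ω) (E.Z ω) (E.y ω)

/-- Score contribution `ζ_j^{γ̂}` from which the test is computed. -/
def zetaHat (β₀ : ℝ) (j : Fin E.N) (ω : E.Ω) : ℝ :=
  scoreContribution β₀ (E.What ω) (E.x ω) (E.Z ω) (E.y ω) (E.gammaEst β₀ ω) j

/-- Sign-flipped score statistics `S(F_b) = n^{-1/2} ∑_j s_j^b ζ_j^{γ̂}`, for `b = 1, …, B`. -/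
def flippedScore (β₀ : ℝ) (ω : E.Ω) (b : Fin B) : ℝ :=
  (E.total : ℝ) ^ (-(1 / 2) : ℝ) * ∑ j, E.sign ω b j * E.zetaHat β₀ j ω

/-- The event that the test rejects: `S(F_1)` exceeds the `⌈(1 - α) B⌉`-th order statistic of
`S(F_1), …, S(F_B)`. The first transformation has index `0` in `Fin B`. -/
def rejectionEvent [NeZero B] (β₀ α : ℝ) : Set E.Ω :=
  {ω | orderStat (E.flippedScore β₀ ω) ⌈(1 - α) * (B : ℝ)⌉₊ < E.flippedScore β₀ ω 0}

/-- Standing conditions on the data: random objects are measurable, responses have a mean, clusters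
are independent, the weight matrices are symmetric positive definite, and the working weights are
functions of the covariates (e.g. constants). -/
structure DataConditions : Prop where
  isProbabilityMeasure : IsProbabilityMeasure E.P
  measurable_observed : Measurable E.observed
  integrable_y : ∀ i, Integrable (fun ω => E.y ω i) E.P
  indep_clusters : iIndepFun E.clusterData E.P
  posDef_W : ∀ ω j, (E.W ω j).PosDef
  posDef_What : ∀ ω j, (E.What ω j).PosDef
  measurable_W : ∀ j a b, Measurable[E.designSigma] fun ω => E.W ω j a b

/-- The sign vectors: the first transformation is the identity, the others are independent and
uniformly distributed over all clusterwise sign patterns, independently of the data. -/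
structure SignConditions [NeZero B] : Prop where
  measurable_sign : Measurable E.sign
  sign_first : ∀ ω j, E.sign ω 0 j = 1
  prob_pos : ∀ b, b ≠ 0 → ∀ j, E.P {ω | E.sign ω b j = 1} = 1 / 2
  prob_neg : ∀ b, b ≠ 0 → ∀ j, E.P {ω | E.sign ω b j = -1} = 1 / 2
  indep_signs : iIndepFun (fun (p : {b : Fin B // b ≠ 0} × Fin E.N) ω => E.sign ω p.1 p.2) E.P
  indep_data : IndepFun E.observed E.sign E.P

/-- Correct conditional mean: `E(y_j | x_j, Z_j) = x_j β + Z_j γ` for every cluster `j`. -/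
def MeanModel (β : ℝ) (γ : Fin q → ℝ) : Prop :=
  ∀ (j : Fin E.N) (i : Fin (E.size j)),
    E.P[fun ω => E.y ω ⟨j, i⟩ | E.clusterSigma j] =ᵐ[E.P]
      fun ω => E.x ω ⟨j, i⟩ * β + (E.Z ω *ᵥ γ) ⟨j, i⟩

end ClusterExperiment

/-! ### Asymptotic conditions on a sequence of experiments -/

/-- `X_k = O_p(1)` for nonnegative `X_k`, possibly on different probability spaces. -/
def IsBigOp {q B : ℕ} (E : ℕ → ClusterExperiment.{u} q B) (X : ∀ k, (E k).Ω → ℝ) : Prop :=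
  ∀ ε > (0 : ℝ), ∃ C : ℝ, ∀ᶠ k in atTop, (E k).P {ω | C < |X k ω|} ≤ ENNReal.ofReal ε

/-- `X_k = o_p(1)`, possibly on different probability spaces. -/
def IsLittleOp {q B : ℕ} (E : ℕ → ClusterExperiment.{u} q B) (X : ∀ k, (E k).Ω → ℝ) : Prop :=
  ∀ ε > (0 : ℝ), Tendsto (fun k => (E k).P {ω | ε < |X k ω|}) atTop (𝓝 0)

section Asymptotics

variable {q B : ℕ} (E : ℕ → ClusterExperiment.{u} q B) (β₀ : ℝ) (γstar : Fin q → ℝ)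

/-- `max_j n_j / n → 0`. -/
def NegligibleClusters : Prop :=
  Tendsto (fun k => ((E k).maxSize : ℝ) / (E k).total) atTop (𝓝 0)

/-- For some `d > 2`, `n^{-d/2} ∑_j E |ζ_j^{γ⋆}|^d → 0`. -/
def LyapunovCondition : Prop :=
  ∃ d : ℝ, 2 < d ∧
    Tendsto (fun k => ((E k).total : ℝ≥0∞) ^ (-(d / 2)) *
      ∑ j, ∫⁻ ω, ‖(E k).zetaStar β₀ γstar j ω‖ₑ ^ d ∂(E k).P) atTop (𝓝 0)

/-- For some `σ² > 0`, `n⁻¹ ∑_j Var(ζ_j^{γ⋆}) → σ²`; and for every `ε > 0`,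
`n⁻¹ ∑_j E [|ζ_j^{γ⋆}|² 1{|ζ_j^{γ⋆}| > ε √n}] → 0`. -/
def VarianceCondition : Prop :=
  (∃ σsq : ℝ, 0 < σsq ∧
    Tendsto (fun k => ((E k).total : ℝ)⁻¹ *
      ∑ j, variance ((E k).zetaStar β₀ γstar j) (E k).P) atTop (𝓝 σsq)) ∧
  ∀ ε > (0 : ℝ),
    Tendsto (fun k => ((E k).total : ℝ≥0∞)⁻¹ *
      ∑ j, ∫⁻ ω in {ω | ε * √((E k).total : ℝ) < |(E k).zetaStar β₀ γstar j ω|},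
        ‖(E k).zetaStar β₀ γstar j ω‖ₑ ^ 2 ∂(E k).P) atTop (𝓝 0)

/-- Given the covariates, the variance of the score does not degenerate:
`n⁻¹ ∑_j Var(ζ_j^{γ⋆} | x, Z)` is bounded away from `0` in probability. For nonrandom covariates
this follows from `VarianceCondition`. -/
def ConditionallyNondegenerate : Prop :=
  ∀ ε > (0 : ℝ), ∃ δ > (0 : ℝ), ∀ᶠ k in atTop,
    (E k).P {ω | ((E k).total : ℝ)⁻¹ *
      ∑ j, (condVar (E k).designSigma ((E k).zetaStar β₀ γstar j) (E k).P) ω < δ}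
        ≤ ENNReal.ofReal ε

/-- For all large `k`, almost surely, `Zᵀ Ŵ Z` is nonsingular. As `W` and `Ŵ` are positive definite,
this says that `Z` has full column rank, so that `Zᵀ W Z` is nonsingular, too. -/
def NonsingularDesign : Prop :=
  ∀ᶠ k in atTop, ∀ᵐ ω ∂(E k).P, IsUnit (weightedGram ((E k).What ω) ((E k).Z ω)).det

/-- There are deterministic `r_n → ∞`, `r_n ≤ √n`, with `r_n ‖γ̂ - γ⋆‖ = O_p(1)`
(Euclidean norm). -/
def NuisanceRate : Prop :=
  ∃ r : ℕ → ℝ, Tendsto r atTop atTop ∧ (∀ k, r k ≤ √((E k).total : ℝ)) ∧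
    IsBigOp E fun k ω => r k * ‖WithLp.toLp 2 ((E k).gammaEst β₀ ω - γstar)‖

/-- `n^{-1/2} ∑_j |ζ_j^{γ̂} - ζ_j^{γ⋆}| = o_p(1)`. -/
def NegligibleNuisance : Prop :=
  IsLittleOp E fun k ω => ((E k).total : ℝ) ^ (-(1 / 2) : ℝ) *
    ∑ j, |(E k).zetaHat β₀ j ω - (E k).zetaStar β₀ γstar j ω|

end Asymptotics

end

/-!
Given the covariates, the score contributions at the true nuisance parameter are independent and
centred, since the weights are functions of the covariates. This alone makes the vector of observed
and flipped scores asymptotically exchangeable; no central limit theorem and no limit law is needed.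

Let `v j` be the score contributions scaled by `n^{-1/2}`. Integrating out the signs, the
characteristic function of `(S(F_1), …, S(F_B))` is
`E ∏ j, (exp (i t₁ v j) * ∏ b ≥ 2, cos (t_b v j))`, where only the unflipped coordinate `b = 1`
breaks the symmetry (`charFun_map_flippedSum`). Replace its exponential by `cos (t₁ v j)`, one
cluster at a time. The difference `i sin (t₁ u) ∏ b ≥ 2, cos (t_b u)` of the factors is odd in `u`,
so that it is `i t₁ u` up to a cubic error, and the linear part integrates to zero because `v j` is
centred given the covariates and all other clusters. By the Lindeberg condition the errors add up to
`o(1)` (`IsCondCentredArray.norm_integral_prod_exp_sub_prod_cos_le`). The result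
`E ∏ j, ∏ b, cos (t_b v j)` is symmetric in `t`.

The laws are tight, having bounded second moments, so every subsequence has a further one with a
weak limit, and the limit is exchangeable. It has no ties: the characteristic function of
`S(F_b) - S(F_c)` at `τ` is close to `E ∏ j, cos (τ v j) ^ 2`. As `(1 - c) e ^ c ≤ 1`, this is
small for large `τ` wherever the conditional variance is bounded below
(`IsCondCentredArray.integral_prod_cos_sq_le`), and a law whose characteristic function is small at
large arguments has no large atom (`measureReal_inner_eq_zero_le`). Under an exchangeable law
without ties the rank of a coordinate is uniform, and ranks are locally constant away from ties, so
the rank probabilities converge (`tendsto_measureReal_le_rankBelow`).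

Replacing the estimated score contributions by those at the true parameter changes characteristic
functions by `o(1)`, since the signs are bounded by one. The test rejects when at least
`r = ⌈(1 - α) B⌉` of the scores are smaller than `S(F_1)`, which has limiting probability
`(B - r) / B = ⌊α B⌋ / B`.
-/

/-! ### Arrays that are conditionally independent and centred given a σ-algebra -/

/-- `v` is a family of integrable random variables that are conditionally centred and independent
given `G`. Independence is encoded by σ-algebras `𝓗 j ⊇ G` that make all `v k`, `k ≠ j`,
measurable, and given which `v j` has the same conditional law as given `G`. -/
structure IsCondCentredArray {Ω ι : Type*} (G : MeasurableSpace Ω) (𝓗 : ι → MeasurableSpace Ω)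
    [mΩ : MeasurableSpace Ω] (P : Measure Ω) (v : ι → Ω → ℝ) : Prop where
  le_of_index : ∀ j, G ≤ 𝓗 j
  le : ∀ j, 𝓗 j ≤ mΩ
  measurable_of_ne : ∀ j k, k ≠ j → Measurable[𝓗 j] (v k)
  integrable : ∀ j, Integrable (v j) P
  measurable : ∀ j, Measurable (v j)
  condExp_eq_zero : ∀ j, P[v j | G] =ᵐ[P] 0
  condExp_comp : ∀ j (φ : ℝ → ℝ), Measurable φ → Integrable (fun ω => φ (v j ω)) P →
    P[fun ω => φ (v j ω) | 𝓗 j] =ᵐ[P] P[fun ω => φ (v j ω) | G]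

lemma half_sq_le_sin_sq {x : ℝ} (hx : |x| ≤ 1) : x ^ 2 / 2 ≤ Real.sin x ^ 2 := by
  wlog h : 0 ≤ x generalizing x
  · have := this (x := -x) (by rwa [abs_neg]) (by linarith)
    simpa using this
  rw [abs_of_nonneg h] at hx
  rcases h.eq_or_lt with rfl | h'
  · simp
  have h1 := Real.sin_gt_sub_cube h'
  have h2 : 3 / 4 * x ≤ Real.sin x := by nlinarith [mul_nonneg h (sub_nonneg.2 hx), sq_nonneg x]
  nlinarith

lemma abs_sin_sub_le_cube (x : ℝ) : |Real.sin x - x| ≤ |x| ^ 3 := by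
  wlog h : 0 ≤ x generalizing x
  · have := this (-x) (by linarith)
    rw [Real.sin_neg, abs_neg] at this
    rwa [show -Real.sin x - -x = -(Real.sin x - x) by ring, abs_neg] at this
  rcases h.eq_or_lt with rfl | h'
  · simp
  have h1 := Real.sin_gt_sub_cube h'
  have h2 := Real.sin_le h
  rw [abs_of_nonneg h, abs_of_nonpos (by linarith)]
  have : 0 < x ^ 3 := by positivity
  linarith

lemma one_sub_prod_cos_le {β : Type*} (s : Finset β) (t : β → ℝ) (u : ℝ) :
    |1 - ∏ b ∈ s, Real.cos (t b * u)| ≤ (∑ b ∈ s, t b ^ 2) * u ^ 2 := by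
  classical
  induction s using Finset.induction_on with
  | empty => simp
  | insert a s ha ih =>
    rw [Finset.prod_insert ha, Finset.sum_insert ha]
    have h1 : |1 - Real.cos (t a * u)| ≤ t a ^ 2 * u ^ 2 := by
      rw [abs_of_nonneg (by linarith [Real.cos_le_one (t a * u)])]
      have := Real.one_sub_sq_div_two_le_cos (x := t a * u)
      nlinarith [sq_nonneg (t a * u)]
    have e : 1 - Real.cos (t a * u) * ∏ b ∈ s, Real.cos (t b * u)
      = (1 - Real.cos (t a * u)) + Real.cos (t a * u) * (1 - ∏ b ∈ s, Real.cos (t b * u)) := by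
      ring
    rw [e]
    refine (abs_add_le _ _).trans ?_
    rw [abs_mul]
    have h2 : |Real.cos (t a * u)| * |1 - ∏ b ∈ s, Real.cos (t b * u)|
      ≤ 1 * |1 - ∏ b ∈ s, Real.cos (t b * u)| := by
      gcongr; exact Real.abs_cos_le_one _
    linarith

namespace IsCondCentredArray

variable {Ω ι : Type*} {G : MeasurableSpace Ω} {𝓗 : ι → MeasurableSpace Ω}
  [mΩ : MeasurableSpace Ω] {P : Measure Ω} {v : ι → Ω → ℝ}

lemma const_mul (hv : IsCondCentredArray G 𝓗 P v) (c : ℝ) :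
    IsCondCentredArray G 𝓗 P fun j ω => c * v j ω where
  le_of_index := hv.le_of_index
  le := hv.le
  measurable_of_ne j k hkj := (hv.measurable_of_ne j k hkj).const_mul c
  integrable j := (hv.integrable j).const_mul c
  measurable j := (hv.measurable j).const_mul c
  condExp_eq_zero j := by
    have h := condExp_smul (μ := P) c (v j) G
    filter_upwards [h, hv.condExp_eq_zero j] with ω h1 h2
    change (P[c • v j | G]) ω = 0
    simp [h1, h2]
  condExp_comp j φ hφ hi :=
    hv.condExp_comp j (fun u => φ (c * u)) (hφ.comp (measurable_const_mul c)) hi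

lemma condExp_index_eq_zero (hv : IsCondCentredArray G 𝓗 P v) (j : ι) :
    P[v j | 𝓗 j] =ᵐ[P] 0 :=
  (hv.condExp_comp j id measurable_id (hv.integrable j)).trans (hv.condExp_eq_zero j)

variable [IsProbabilityMeasure P]

lemma integral_smul_eq_zero (hv : IsCondCentredArray G 𝓗 P v) (j : ι) {h : Ω → ℂ}
    (hm : StronglyMeasurable[𝓗 j] h) (hi : Integrable (fun ω => v j ω • h ω) P) :
    ∫ ω, v j ω • h ω ∂P = 0 := by
  have h1 := condExp_bilin_of_stronglyMeasurable_right (μ := P) (m := 𝓗 j)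
    (ContinuousLinearMap.lsmul ℝ ℝ : ℝ →L[ℝ] ℂ →L[ℝ] ℂ) hm hi (hv.integrable j)
  rw [← integral_condExp (hv.le j)]
  rw [integral_eq_zero_of_ae]
  filter_upwards [h1, hv.condExp_index_eq_zero j] with ω h1 h2
  change (P[fun ω => (ContinuousLinearMap.lsmul ℝ ℝ : ℝ →L[ℝ] ℂ →L[ℝ] ℂ) (v j ω) (h ω)|𝓗 j]) ω = 0
  rw [h1, h2]; simp

lemma integral_mul_eq_zero (hv : IsCondCentredArray G 𝓗 P v) {j k : ι} (hjk : k ≠ j)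
    (hL : ∀ j, MemLp (v j) 2 P) : ∫ ω, v j ω * v k ω ∂P = 0 := by
  have hi : Integrable (v j * v k) P := (hL j).integrable_mul (hL k)
  have h1 := condExp_mul_of_stronglyMeasurable_right (μ := P) (m := 𝓗 j)
    (hv.measurable_of_ne j k hjk).stronglyMeasurable hi (hv.integrable j)
  change ∫ ω, (v j * v k) ω ∂P = 0
  rw [← integral_condExp (hv.le j), integral_eq_zero_of_ae]
  filter_upwards [h1, hv.condExp_index_eq_zero j] with ω h1 h2
  simp [h1, h2]

/-- The error of replacing the factors `A (v j)` by `C (v j)` one at a time: as `v j` is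
conditionally centred given the other variables, the linear part of `A - C` contributes nothing. -/
lemma norm_integral_prod_sub_prod_le [Fintype ι] (hv : IsCondCentredArray G 𝓗 P v)
    {A C : ℝ → ℂ} {ρ : ℝ → ℝ} {κ : ℂ} (hA : Measurable A) (hC : Measurable C)
    (hA1 : ∀ u, ‖A u‖ ≤ 1) (hC1 : ∀ u, ‖C u‖ ≤ 1)
    (hρ : ∀ u, ‖A u - C u - u • κ‖ ≤ ρ u) (hρi : ∀ j, Integrable (fun ω => ρ (v j ω)) P) :
    ‖(∫ ω, ∏ j, A (v j ω) ∂P) - ∫ ω, ∏ j, C (v j ω) ∂P‖ ≤ ∑ j, ∫ ω, ρ (v j ω) ∂P := by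
  classical
  let F : Finset ι → ι → ℝ → ℂ := fun s j => if j ∈ s then A else C
  have hFm : ∀ s j, Measurable (F s j) := fun s j => by
    dsimp only [F]; split_ifs <;> assumption
  have hF1 : ∀ s j u, ‖F s j u‖ ≤ 1 := fun s j u => by
    dsimp only [F]; split_ifs
    · exact hA1 u
    · exact hC1 u
  have hprod1 : ∀ s (t : Finset ι) ω, ‖∏ j ∈ t, F s j (v j ω)‖ ≤ 1 := fun s t ω => by
    rw [norm_prod]
    exact Finset.prod_le_one (fun _ _ => norm_nonneg _) fun j _ => hF1 s j _
  have hint : ∀ s (t : Finset ι), Integrable (fun ω => ∏ j ∈ t, F s j (v j ω)) P := fun s t =>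
    Integrable.of_bound (Finset.measurable_fun_prod t fun j _ =>
      (hFm s j).comp (hv.measurable j)).aestronglyMeasurable 1 (.of_forall (hprod1 s t))
  have key : ∀ s : Finset ι, ‖(∫ ω, ∏ j, F s j (v j ω) ∂P) - ∫ ω, ∏ j, C (v j ω) ∂P‖
      ≤ ∑ j ∈ s, ∫ ω, ρ (v j ω) ∂P := by
    intro s
    induction s using Finset.induction_on with
    | empty => simp [F]
    | insert a s ha ih =>
      rw [Finset.sum_insert ha]
      refine (norm_sub_le_norm_sub_add_norm_sub _ (∫ ω, ∏ j, F s j (v j ω) ∂P) _).trans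
        (add_le_add ?_ ih)
      let h : Ω → ℂ := fun ω => ∏ j ∈ Finset.univ.erase a, F s j (v j ω)
      have hh1 : ∀ ω, ‖h ω‖ ≤ 1 := hprod1 s _
      have hhm : StronglyMeasurable[𝓗 a] h := by
        refine Measurable.stronglyMeasurable ?_
        refine Finset.measurable_fun_prod _ fun j hj => ?_
        exact (hFm s j).comp (hv.measurable_of_ne a j (Finset.ne_of_mem_erase hj))
      have hhm' : AEStronglyMeasurable h P := (hhm.mono (hv.le a)).aestronglyMeasurable
      have e1 : ∀ ω, ∏ j, F (insert a s) j (v j ω) = A (v a ω) * h ω := fun ω => by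
        rw [← Finset.mul_prod_erase _ _ (Finset.mem_univ a)]
        congr 1
        · simp [F]
        · refine Finset.prod_congr rfl fun j hj => ?_
          simp [F, Finset.ne_of_mem_erase hj]
      have e2 : ∀ ω, ∏ j, F s j (v j ω) = C (v a ω) * h ω := fun ω => by
        rw [← Finset.mul_prod_erase _ _ (Finset.mem_univ a)]
        simp [F, ha, h]
      have hlin : Integrable (fun ω => v a ω • (κ * h ω)) P := by
        refine ((hv.integrable a).norm.mul_const ‖κ‖).mono'
          ((hv.measurable a).aestronglyMeasurable.smul (hhm'.const_mul κ)) (.of_forall fun ω => ?_)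
        rw [norm_smul, norm_mul]
        have := mul_le_of_le_one_right (norm_nonneg κ) (hh1 ω)
        gcongr
      have h0 := hv.integral_smul_eq_zero a (h := fun ω => κ * h ω) (hhm.const_mul κ) hlin
      have hAi : Integrable (fun ω => A (v a ω) * h ω) P := by
        have := hint (insert a s) Finset.univ
        simpa only [e1] using this
      have hCi : Integrable (fun ω => C (v a ω) * h ω) P := by
        have := hint s Finset.univ
        simpa only [e2] using this
      simp only [e1, e2]
      have e3 : (∫ ω, A (v a ω) * h ω ∂P) - ∫ ω, C (v a ω) * h ω ∂P
          = ∫ ω, (A (v a ω) - C (v a ω) - v a ω • κ) * h ω ∂P := by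
        have hd : Integrable (fun ω => A (v a ω) * h ω - C (v a ω) * h ω) P := hAi.sub hCi
        rw [← integral_sub hAi hCi, ← sub_zero (∫ ω, _ - _ ∂P), ← h0, ← integral_sub hd hlin]
        congr with ω
        simp only [Complex.real_smul]; ring
      rw [e3]
      refine norm_integral_le_of_norm_le (hρi a) (.of_forall fun ω => ?_)
      rw [norm_mul]
      exact (mul_le_of_le_one_right (norm_nonneg _) (hh1 ω)).trans (hρ _)
  simpa [F] using key Finset.univ

/-- Peeling off the factors one at a time, with `(1 - c) e ^ c ≤ 1`. -/
lemma integral_prod_mul_exp_le_one [Fintype ι] (hv : IsCondCentredArray G 𝓗 P v)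
    {φ : ℝ → ℝ} (hφ : Measurable φ) (h0 : ∀ u, 0 ≤ φ u) (h1 : ∀ u, φ u ≤ 1) (s : Finset ι) :
    Integrable (fun ω => ∏ j ∈ s, (φ (v j ω) * Real.exp (P[fun ω => 1 - φ (v j ω) | G] ω))) P ∧
    ∫ ω, ∏ j ∈ s, (φ (v j ω) * Real.exp (P[fun ω => 1 - φ (v j ω) | G] ω)) ∂P ≤ 1 := by
  classical
  let c : ι → Ω → ℝ := fun j => P[fun ω => 1 - φ (v j ω) | G]
  have hφi : ∀ j, Integrable (fun ω => φ (v j ω)) P := fun j =>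
    Integrable.of_bound (hφ.comp (hv.measurable j)).aestronglyMeasurable 1 (.of_forall fun ω => by
      rw [Real.norm_eq_abs, abs_of_nonneg (h0 _)]; exact h1 _)
  have hc0 : ∀ j, ∀ᵐ ω ∂P, 0 ≤ c j ω := fun j =>
    condExp_nonneg (.of_forall fun ω => sub_nonneg.2 (h1 (v j ω)))
  have hG : ∀ j : ι, G ≤ mΩ := fun j => (hv.le_of_index j).trans (hv.le j)
  have hceq : ∀ j, ∀ᵐ ω ∂P, c j ω = 1 - P[fun ω => φ (v j ω) | G] ω := fun j => by
    have := condExp_sub (μ := P) (integrable_const (1 : ℝ)) (hφi j) G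
    rw [condExp_const (hG j)] at this
    filter_upwards [this] with ω hω using hω
  have hc1 : ∀ j, ∀ᵐ ω ∂P, c j ω ≤ 1 := fun j => by
    have : 0 ≤ᵐ[P] P[fun ω => φ (v j ω) | G] := condExp_nonneg (.of_forall fun ω => h0 (v j ω))
    filter_upwards [hceq j, this] with ω h2 h3
    have h3 : 0 ≤ P[fun ω => φ (v j ω) | G] ω := h3
    linarith
  have hcm : ∀ j, StronglyMeasurable[G] (c j) := fun j => stronglyMeasurable_condExp
  change Integrable (fun ω => ∏ j ∈ s, (φ (v j ω) * Real.exp (c j ω))) P ∧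
    ∫ ω, ∏ j ∈ s, (φ (v j ω) * Real.exp (c j ω)) ∂P ≤ 1
  have hfac : ∀ j, ∀ᵐ ω ∂P, ‖φ (v j ω) * Real.exp (c j ω)‖ ≤ Real.exp 1 := fun j => by
    filter_upwards [hc1 j] with ω hω
    rw [Real.norm_eq_abs, abs_mul, abs_of_nonneg (h0 _), Real.abs_exp]
    exact (mul_le_of_le_one_left (Real.exp_pos _).le (h1 _)).trans (Real.exp_le_exp.2 hω)
  have hbd : ∀ t : Finset ι, ∀ᵐ ω ∂P,
      ‖∏ j ∈ t, (φ (v j ω) * Real.exp (c j ω))‖ ≤ Real.exp 1 ^ t.card := fun t => by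
    have := ae_all_iff.2 hfac
    filter_upwards [this] with ω hω
    rw [norm_prod]
    exact (Finset.prod_le_prod (fun _ _ => norm_nonneg _) fun j _ => hω j).trans_eq
      (Finset.prod_const _)
  have hmeas : ∀ t : Finset ι, Measurable fun ω => ∏ j ∈ t, (φ (v j ω) * Real.exp (c j ω)) :=
    fun t => Finset.measurable_fun_prod t fun j _ => (hφ.comp (hv.measurable j)).mul
      (Real.measurable_exp.comp ((hcm j).mono (hG j)).measurable)
  have hint : ∀ t : Finset ι, Integrable (fun ω => ∏ j ∈ t, (φ (v j ω) * Real.exp (c j ω))) P :=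
    fun t => Integrable.of_bound (hmeas t).aestronglyMeasurable _ (hbd t)
  refine ⟨hint s, ?_⟩
  induction s using Finset.induction_on with
  | empty => simp
  | insert a s ha ih =>
    let h : Ω → ℝ := fun ω => Real.exp (c a ω) * ∏ j ∈ s, (φ (v j ω) * Real.exp (c j ω))
    have hhm : StronglyMeasurable[𝓗 a] h := by
      refine Measurable.stronglyMeasurable ?_
      have hc' : ∀ j, Measurable[𝓗 a] (c j) := fun j => ((hcm j).mono (hv.le_of_index a)).measurable
      refine (Real.measurable_exp.comp (hc' a)).mul (Finset.measurable_fun_prod _ fun j hj => ?_)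
      exact (hφ.comp (hv.measurable_of_ne a j (fun e => ha (e ▸ hj)))).mul
        (Real.measurable_exp.comp (hc' j))
    have hhb : ∀ᵐ ω ∂P, ‖h ω‖ ≤ Real.exp 1 * Real.exp 1 ^ s.card := by
      filter_upwards [hc1 a, hbd s] with ω h2 h3
      rw [norm_mul, Real.norm_eq_abs, Real.abs_exp]
      gcongr
    have hpull := condExp_stronglyMeasurable_mul_of_bound (hv.le a) hhm (hφi a) _ hhb
    have e1 : ∀ ω, ∏ j ∈ insert a s, (φ (v j ω) * Real.exp (c j ω))
        = (h * fun ω => φ (v a ω)) ω := fun ω => by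
      rw [Finset.prod_insert ha]; simp only [h, Pi.mul_apply]; ring
    simp only [e1]
    rw [← integral_condExp (hv.le a)]
    refine le_trans (integral_mono_ae integrable_condExp (hint s) ?_) ih
    filter_upwards [hpull, hv.condExp_comp a φ hφ (hφi a), hceq a] with ω h2 h3 h4
    rw [h2, Pi.mul_apply, h3]
    have h5 : P[fun ω => φ (v a ω) | G] ω = 1 - c a ω := by rw [h4]; ring
    rw [h5]
    have h6 : 0 ≤ ∏ j ∈ s, (φ (v j ω) * Real.exp (c j ω)) :=
      Finset.prod_nonneg fun j _ => mul_nonneg (h0 _) (Real.exp_pos _).le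
    have h7 : Real.exp (c a ω) * (1 - c a ω) ≤ 1 := by
      have := Real.one_sub_le_exp_neg (c a ω)
      calc _ ≤ Real.exp (c a ω) * Real.exp (-c a ω) := by gcongr
        _ = 1 := by rw [← Real.exp_add]; simp
    calc h ω * (1 - c a ω)
        = Real.exp (c a ω) * (1 - c a ω) * ∏ j ∈ s, (φ (v j ω) * Real.exp (c j ω)) := by
          simp only [h]; ring
      _ ≤ _ := mul_le_of_le_one_left h6 h7

/-- The mean of a product of factors in `[0, 1]` is small unless the conditional means of the
factors are close to one. -/
lemma integral_prod_le [Fintype ι] (hv : IsCondCentredArray G 𝓗 P v)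
    {φ : ℝ → ℝ} (hφ : Measurable φ) (h0 : ∀ u, 0 ≤ φ u) (h1 : ∀ u, φ u ≤ 1) (L : ℝ) :
    ∫ ω, ∏ j, φ (v j ω) ∂P ≤
      P.real {ω | ∑ j, P[fun ω => 1 - φ (v j ω) | G] ω < L} + Real.exp (-L) := by
  obtain ⟨hi, hle⟩ := hv.integral_prod_mul_exp_le_one hφ h0 h1 Finset.univ
  let X : Ω → ℝ := fun ω => ∑ j, P[fun ω => 1 - φ (v j ω) | G] ω
  have hXm : Measurable X := Finset.measurable_fun_sum _ fun j _ =>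
    (stronglyMeasurable_condExp.mono ((hv.le_of_index j).trans (hv.le j))).measurable
  have hS : MeasurableSet {ω | X ω < L} := measurableSet_lt hXm measurable_const
  have hi1 : Integrable ({ω | X ω < L}.indicator (fun _ => (1 : ℝ))) P :=
    (integrable_const _).indicator hS
  have e : P.real {ω | X ω < L} = ∫ ω, {ω | X ω < L}.indicator (fun _ => (1 : ℝ)) ω ∂P := by
    rw [integral_indicator hS]; simp
  change _ ≤ P.real {ω | X ω < L} + _
  have hp1 : ∀ ω, ∏ j, φ (v j ω) ≤ 1 := fun ω =>
    Finset.prod_le_one (fun j _ => h0 _) fun j _ => h1 _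
  have hp0 : ∀ ω, 0 ≤ ∏ j, φ (v j ω) := fun ω => Finset.prod_nonneg fun j _ => h0 _
  have hpi : Integrable (fun ω => ∏ j, φ (v j ω)) P :=
    Integrable.of_bound (Finset.measurable_fun_prod _ fun j _ =>
      hφ.comp (hv.measurable j)).aestronglyMeasurable 1 (.of_forall fun ω => by
        rw [Real.norm_eq_abs, abs_of_nonneg (hp0 ω)]; exact hp1 ω)
  calc ∫ ω, ∏ j, φ (v j ω) ∂P
      ≤ ∫ ω, ({ω | X ω < L}.indicator (fun _ => (1 : ℝ)) ω + Real.exp (-L) *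
        ∏ j, (φ (v j ω) * Real.exp (P[fun ω => 1 - φ (v j ω) | G] ω))) ∂P := by
        refine integral_mono hpi (hi1.add (hi.const_mul _)) fun ω => ?_
        dsimp only
        have e2 : ∏ j, (φ (v j ω) * Real.exp (P[fun ω => 1 - φ (v j ω) | G] ω))
          = (∏ j, φ (v j ω)) * Real.exp (X ω) := by
          rw [Finset.prod_mul_distrib, ← Real.exp_sum]
        rw [e2]
        have hp := hp0 ω
        by_cases hω : X ω < L
        · rw [Set.indicator_of_mem (by exact hω)]
          have : 0 ≤ Real.exp (-L) * ((∏ j, φ (v j ω)) * Real.exp (X ω)) := by positivity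
          linarith [hp1 ω]
        · rw [Set.indicator_of_notMem (by exact hω), zero_add]
          have : 1 ≤ Real.exp (-L) * Real.exp (X ω) := by
            rw [← Real.exp_add]; exact Real.one_le_exp (by linarith)
          nlinarith
    _ = P.real {ω | X ω < L} + Real.exp (-L) *
        ∫ ω, ∏ j, (φ (v j ω) * Real.exp (P[fun ω => 1 - φ (v j ω) | G] ω)) ∂P := by
        rw [integral_add hi1 (hi.const_mul _), e, integral_const_mul]
    _ ≤ _ := by
        have := mul_le_of_le_one_right (Real.exp_pos (-L)).le hle
        linarith

open Complex in
/-- Comparison of characteristic functions: since `exp (i t₀ u) g u - cos (t₀ u) g u` is odd in `u`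
for even `g`, it is linear in `u` up to a cubic error. -/
lemma norm_integral_prod_exp_sub_prod_cos_le [Fintype ι] (hv : IsCondCentredArray G 𝓗 P v)
    (hL : ∀ j, MemLp (v j) 2 P) {β : Type*} (s : Finset β) (t : β → ℝ) (t₀ : ℝ) {τ : ℝ}
    (hτ : 0 < τ) :
    ‖(∫ ω, ∏ j, (cexp ((t₀ * v j ω : ℝ) * I) * (∏ b ∈ s, Real.cos (t b * v j ω) : ℝ)) ∂P)
      - ∫ ω, ∏ j, (Real.cos (t₀ * v j ω) * ∏ b ∈ s, Real.cos (t b * v j ω)) ∂P‖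
      ≤ |t₀| * (t₀ ^ 2 + ∑ b ∈ s, t b ^ 2) * τ * ∑ j, ∫ ω, v j ω ^ 2 ∂P
        + 2 * |t₀| / τ * ∑ j, ∫ ω in {ω | τ < |v j ω|}, v j ω ^ 2 ∂P := by
  let g : ℝ → ℝ := fun u => ∏ b ∈ s, Real.cos (t b * u)
  have hgm : Measurable g := Finset.measurable_fun_prod _ fun b _ => by fun_prop
  have hg1 : ∀ u, |g u| ≤ 1 := fun u => by
    rw [Finset.abs_prod]
    exact Finset.prod_le_one (fun _ _ => abs_nonneg _) fun b _ => Real.abs_cos_le_one _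
  let K : ℝ := ∑ b ∈ s, t b ^ 2
  have hK0 : 0 ≤ K := Finset.sum_nonneg fun b _ => sq_nonneg _
  let M : ℝ := |t₀| * (t₀ ^ 2 + K)
  let A : ℝ → ℂ := fun u => cexp ((t₀ * u : ℝ) * I) * (g u : ℝ)
  let C : ℝ → ℂ := fun u => ((Real.cos (t₀ * u) * g u : ℝ) : ℂ)
  let ρ : ℝ → ℝ := fun u =>
    M * τ * u ^ 2 + 2 * |t₀| / τ * {u | τ < |u|}.indicator (fun u => u ^ 2) u
  have hAm : Measurable A := by fun_prop
  have hCm : Measurable C := by fun_prop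
  have hA1 : ∀ u, ‖A u‖ ≤ 1 := fun u => by
    dsimp only [A]
    rw [norm_mul, norm_exp_ofReal_mul_I, one_mul, norm_real]; exact hg1 u
  have hC1 : ∀ u, ‖C u‖ ≤ 1 := fun u => by
    dsimp only [C]
    rw [norm_real, norm_mul]
    exact mul_le_one₀ (Real.abs_cos_le_one _) (abs_nonneg _) (hg1 u)
  have hρ : ∀ u, ‖A u - C u - u • ((t₀ : ℂ) * I)‖ ≤ ρ u := fun u => by
    have e : A u - C u - u • ((t₀ : ℂ) * I) = ((Real.sin (t₀ * u) * g u - t₀ * u : ℝ) : ℂ) * I := by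
      dsimp only [A, C]
      rw [exp_mul_I, real_smul]
      push_cast
      ring
    rw [e, norm_mul, norm_I, mul_one, norm_real, Real.norm_eq_abs]
    by_cases hu : τ < |u|
    · have hind : {u | τ < |u|}.indicator (fun u => u ^ 2) u = u ^ 2 :=
        Set.indicator_of_mem (by exact hu) _
      have h1 : |Real.sin (t₀ * u) * g u| ≤ |t₀ * u| := by
        rw [abs_mul]
        exact (mul_le_of_le_one_right (abs_nonneg _) (hg1 u)).trans Real.abs_sin_le_abs
      have h2 := abs_sub (Real.sin (t₀ * u) * g u) (t₀ * u)
      have h3 : |u| ≤ u ^ 2 / τ := by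
        rw [le_div_iff₀ hτ, ← sq_abs]; nlinarith [abs_nonneg u]
      have h4 : 0 ≤ M * τ * u ^ 2 := by positivity
      dsimp only [ρ]
      rw [hind]
      calc _ ≤ 2 * |t₀| * |u| := by linarith [abs_mul t₀ u]
        _ ≤ 2 * |t₀| * (u ^ 2 / τ) := by gcongr
        _ = 2 * |t₀| / τ * u ^ 2 := by ring
        _ ≤ _ := by linarith
    · have hind : {u | τ < |u|}.indicator (fun u => u ^ 2) u = 0 :=
        Set.indicator_of_notMem (by exact hu) _
      dsimp only [ρ]
      rw [hind, mul_zero, add_zero]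
      have e2 : Real.sin (t₀ * u) * g u - t₀ * u
        = (Real.sin (t₀ * u) - t₀ * u) * g u + -(t₀ * u * (1 - g u)) := by ring
      have h1 : |(Real.sin (t₀ * u) - t₀ * u) * g u| ≤ |t₀ * u| ^ 3 := by
        rw [abs_mul]
        exact (mul_le_of_le_one_right (abs_nonneg _) (hg1 u)).trans (abs_sin_sub_le_cube _)
      have h2 : |t₀ * u * (1 - g u)| ≤ |t₀ * u| * (K * u ^ 2) := by
        rw [abs_mul]
        exact mul_le_mul_of_nonneg_left (one_sub_prod_cos_le s t u) (abs_nonneg _)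
      rw [e2]
      refine (abs_add_le _ _).trans ?_
      rw [abs_neg]
      calc _ ≤ |t₀ * u| ^ 3 + |t₀ * u| * (K * u ^ 2) := add_le_add h1 h2
        _ = M * |u| * u ^ 2 := by
          rw [abs_mul, mul_pow, pow_succ |t₀| 2, pow_succ |u| 2, sq_abs, sq_abs]; ring
        _ ≤ M * τ * u ^ 2 := by
          have := not_lt.1 hu
          gcongr
  have hS : ∀ j, MeasurableSet {ω | τ < |v j ω|} := fun j =>
    measurableSet_lt measurable_const (measurable_abs.comp (hv.measurable j))
  have hi1 : ∀ j, Integrable (fun ω => M * τ * v j ω ^ 2) P := fun j =>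
    (hL j).integrable_sq.const_mul _
  have hi2 : ∀ j, Integrable (fun ω => 2 * |t₀| / τ *
      {ω | τ < |v j ω|}.indicator (fun ω => v j ω ^ 2) ω) P := fun j =>
    ((hL j).integrable_sq.indicator (hS j)).const_mul _
  have := hv.norm_integral_prod_sub_prod_le hAm hCm hA1 hC1 hρ fun j => (hi1 j).add (hi2 j)
  have hC' : ((∫ ω, ∏ j, (Real.cos (t₀ * v j ω) * ∏ b ∈ s, Real.cos (t b * v j ω)) ∂P : ℝ) : ℂ)
      = ∫ ω, ∏ j, C (v j ω) ∂P := by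
    refine integral_complex_ofReal.symm.trans ?_
    simp only [C, g, ofReal_prod]
  rw [hC']
  refine this.trans_eq ?_
  rw [Finset.mul_sum, Finset.mul_sum, ← Finset.sum_add_distrib]
  refine Finset.sum_congr rfl fun j _ => ?_
  rw [← integral_indicator (hS j), ← integral_const_mul, ← integral_const_mul,
    ← integral_add (hi1 j) (hi2 j)]
  rfl

/-- Bound on the characteristic function of a difference of two flipped scores: it is small at large
arguments unless the conditional variance `∑ j, E[(v j)² | G]` is. -/
lemma integral_prod_cos_sq_le [Fintype ι] (hv : IsCondCentredArray G 𝓗 P v)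
    (hL : ∀ j, MemLp (v j) 2 P) {τ δ : ℝ} (hτ : τ ≠ 0) (hδ : 0 < δ) :
    ∫ ω, ∏ j, Real.cos (τ * v j ω) ^ 2 ∂P ≤
      P.real {ω | ∑ j, P[fun ω => v j ω ^ 2 | G] ω < δ}
      + 2 / δ * ∑ j, ∫ ω in {ω | |τ|⁻¹ < |v j ω|}, v j ω ^ 2 ∂P
      + Real.exp (-(τ ^ 2 * δ / 4)) := by
  have hG : ∀ j : ι, G ≤ mΩ := fun j => (hv.le_of_index j).trans (hv.le j)
  have hS : ∀ j, MeasurableSet {ω | |τ|⁻¹ < |v j ω|} := fun j =>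
    measurableSet_lt measurable_const (measurable_abs.comp (hv.measurable j))
  have hsq : ∀ j, Integrable (fun ω => v j ω ^ 2) P := fun j => (hL j).integrable_sq
  -- the part of `(v j)²` where `v j` is large
  let w : ι → Ω → ℝ := fun j => {ω | |τ|⁻¹ < |v j ω|}.indicator fun ω => v j ω ^ 2
  have hwi : ∀ j, Integrable (w j) P := fun j => (hsq j).indicator (hS j)
  have hw0 : ∀ j ω, 0 ≤ w j ω := fun j ω => Set.indicator_nonneg (fun _ _ => sq_nonneg _) ω
  have hlow : ∀ j ω, τ ^ 2 / 2 * (v j ω ^ 2 - w j ω) ≤ 1 - Real.cos (τ * v j ω) ^ 2 := by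
    intro j ω
    by_cases h : |τ|⁻¹ < |v j ω|
    · have : w j ω = v j ω ^ 2 := Set.indicator_of_mem (s := {ω | |τ|⁻¹ < |v j ω|}) h _
      rw [this, sub_self, mul_zero]
      nlinarith [Real.cos_sq_add_sin_sq (τ * v j ω), sq_nonneg (Real.sin (τ * v j ω))]
    · have : w j ω = 0 := Set.indicator_of_notMem (s := {ω | |τ|⁻¹ < |v j ω|}) h _
      rw [this, sub_zero, ← Real.sin_sq]
      have hx : |τ * v j ω| ≤ 1 := by
        rw [abs_mul]
        have := mul_le_mul_of_nonneg_left (not_lt.1 h) (abs_nonneg τ)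
        rwa [mul_inv_cancel₀ (abs_ne_zero.2 hτ)] at this
      have := half_sq_le_sin_sq hx
      nlinarith
  have hcosi : ∀ j, Integrable (fun ω => 1 - Real.cos (τ * v j ω) ^ 2) P := fun j => by
    refine Integrable.of_bound (Measurable.aestronglyMeasurable ?_) 1 (.of_forall fun ω => ?_)
    · have := hv.measurable j; fun_prop
    · rw [← Real.sin_sq, Real.norm_eq_abs, abs_of_nonneg (sq_nonneg _)]
      exact Real.sin_sq_le_one _
  have hce : ∀ᵐ ω ∂P, ∀ j, τ ^ 2 / 2 * (P[fun ω => v j ω ^ 2 | G] ω - P[w j | G] ω)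
      ≤ P[fun ω => 1 - Real.cos (τ * v j ω) ^ 2 | G] ω := by
    refine ae_all_iff.2 fun j => ?_
    have h1 : P[(τ ^ 2 / 2) • ((fun ω => v j ω ^ 2) - w j) | G] ≤ᵐ[P]
        P[fun ω => 1 - Real.cos (τ * v j ω) ^ 2 | G] :=
      condExp_mono (((hsq j).sub (hwi j)).smul _) (hcosi j) (.of_forall fun ω => hlow j ω)
    filter_upwards [h1, condExp_smul (μ := P) (τ ^ 2 / 2) ((fun ω => v j ω ^ 2) - w j) G,
      condExp_sub (hsq j) (hwi j) G] with ω h1 h2 h3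
    rw [h2, Pi.smul_apply, h3] at h1
    exact h1
  have hc0 : ∀ᵐ ω ∂P, ∀ j, 0 ≤ P[w j | G] ω := ae_all_iff.2 fun j =>
    condExp_nonneg (.of_forall (hw0 j))
  -- Markov's inequality for the truncated part
  have hmarkov : P.real {ω | δ / 2 ≤ ∑ j, P[w j | G] ω} ≤
      2 / δ * ∑ j, ∫ ω in {ω | |τ|⁻¹ < |v j ω|}, v j ω ^ 2 ∂P := by
    have h1 := mul_meas_ge_le_integral_of_nonneg (μ := P) (f := fun ω => ∑ j, P[w j | G] ω)
      (by filter_upwards [hc0] with ω hω using Finset.sum_nonneg fun j _ => hω j)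
      (integrable_finsetSum _ fun j _ => integrable_condExp) (δ / 2)
    have h2 : ∫ ω, ∑ j, P[w j | G] ω ∂P = ∑ j, ∫ ω in {ω | |τ|⁻¹ < |v j ω|}, v j ω ^ 2 ∂P := by
      rw [integral_finsetSum _ fun j _ => integrable_condExp]
      refine Finset.sum_congr rfl fun j _ => ?_
      rw [integral_condExp (hG j), integral_indicator (hS j)]
    rw [h2] at h1
    calc _ = 2 / δ * (δ / 2 * P.real {ω | δ / 2 ≤ ∑ j, P[w j | G] ω}) := by field_simp
      _ ≤ _ := by gcongr
  have hφm : Measurable fun u : ℝ => Real.cos (τ * u) ^ 2 := by fun_prop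
  refine (hv.integral_prod_le hφm (fun u => sq_nonneg _) (fun u => Real.cos_sq_le_one _)
    (τ ^ 2 * δ / 4)).trans ?_
  gcongr ?_ + _
  calc _ ≤ P.real ({ω | ∑ j, P[fun ω => v j ω ^ 2 | G] ω < δ} ∪
        {ω | δ / 2 ≤ ∑ j, P[w j | G] ω}) := by
        refine ENNReal.toReal_mono (measure_ne_top _ _) (measure_mono_ae ?_)
        filter_upwards [hce] with ω h1 h3
        by_contra h4
        have h4' : ¬ (_ ∨ _) := h4
        simp only [not_or, Set.mem_ofPred_eq, not_lt, not_le] at h4'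
        have h3' : ∑ j, P[fun ω => 1 - Real.cos (τ * v j ω) ^ 2 | G] ω < τ ^ 2 * δ / 4 := h3
        have h5 := Finset.sum_le_sum fun j (_ : j ∈ Finset.univ) => h1 j
        rw [← Finset.mul_sum, Finset.sum_sub_distrib] at h5
        have h6 : 0 < τ ^ 2 := by positivity
        nlinarith [h4'.1, h4'.2]
    _ ≤ _ := (measureReal_union_le _ _).trans (by gcongr)

end IsCondCentredArray

/-! ### Ranks and order statistics -/

/-- The number of coordinates of `x` that are smaller than the coordinate `c`. -/
noncomputable def rankBelow {B : ℕ} (x : Fin B → ℝ) (c : Fin B) : ℕ :=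
  (Finset.univ.filter fun b => x b < x c).card

lemma card_filter_comp_sort {B : ℕ} (x : Fin B → ℝ) (a : ℝ) :
    (Finset.univ.filter fun i => x (Tuple.sort x i) < a).card
      = (Finset.univ.filter fun b => x b < a).card :=
  Finset.card_equiv (Tuple.sort x) fun i => by simp

lemma orderStat_lt_iff {B : ℕ} (x : Fin B → ℝ) {r : ℕ} (h1 : 1 ≤ r) (h2 : r ≤ B) (c : Fin B) :
    orderStat x r < x c ↔ r ≤ rankBelow x c := by
  have hm : Monotone (x ∘ Tuple.sort x) := Tuple.monotone_sort x
  rw [orderStat, dif_pos ⟨h1, h2⟩, rankBelow, ← card_filter_comp_sort]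
  constructor
  · intro h
    have : Finset.Iic (⟨r - 1, by omega⟩ : Fin B) ⊆
        Finset.univ.filter fun i => x (Tuple.sort x i) < x c := fun i hi => by
      simp only [Finset.mem_filter, Finset.mem_univ, true_and, Finset.mem_Iic] at hi ⊢
      exact (hm hi).trans_lt h
    refine le_trans ?_ (Finset.card_le_card this)
    rw [Fin.card_Iic]
    simp only []; omega
  · intro h
    by_contra hlt
    have : (Finset.univ.filter fun i => x (Tuple.sort x i) < x c) ⊆
        Finset.Iio (⟨r - 1, by omega⟩ : Fin B) := fun i hi => by
      simp only [Finset.mem_filter, Finset.mem_univ, true_and, Finset.mem_Iio] at hi ⊢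
      by_contra h3
      exact hlt ((hm (not_lt.1 h3)).trans_lt hi)
    have h4 := Finset.card_le_card this
    rw [Fin.card_Iio] at h4
    simp only [] at h4
    omega

lemma card_rankBelow_ge {B : ℕ} {x : Fin B → ℝ} (hx : Function.Injective x) (r : ℕ) :
    (Finset.univ.filter fun c => r ≤ rankBelow x c).card = B - r := by
  have hm : StrictMono (x ∘ Tuple.sort x) :=
    (Tuple.monotone_sort x).strictMono_of_injective (hx.comp (Tuple.sort x).injective)
  have hrank : ∀ i, rankBelow x (Tuple.sort x i) = i := fun i => by
    rw [rankBelow, ← card_filter_comp_sort]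
    have : (Finset.univ.filter fun k => x (Tuple.sort x k) < x (Tuple.sort x i))
      = Finset.Iio i := by
      ext k
      simpa using hm.lt_iff_lt
    rw [this, Fin.card_Iio]
  have : (Finset.univ.filter fun c => r ≤ rankBelow x c).card
      = (Finset.univ.filter fun i : Fin B => r ≤ (i : ℕ)).card := by
    refine (Finset.card_equiv (Tuple.sort x) fun i => ?_).symm
    simp [hrank]
  rw [this]
  have h1 := Finset.card_filter_add_card_filter_not (s := (Finset.univ : Finset (Fin B)))
    (fun i : Fin B => (i : ℕ) < r)
  simp only [not_lt, Finset.card_univ, Fintype.card_fin] at h1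
  have h2 : (Finset.univ.filter fun i : Fin B => (i : ℕ) < r).card = min B r := by
    rw [Fin.card_filter_val_lt]
  omega

lemma measurableSet_le_rankBelow {B : ℕ} (r : ℕ) (c : Fin B) :
    MeasurableSet {x : EuclideanSpace ℝ (Fin B) | r ≤ rankBelow x c} := by
  have h : Measurable fun x : EuclideanSpace ℝ (Fin B) => rankBelow x c := by
    simp only [rankBelow, Finset.card_filter]
    refine Finset.measurable_fun_sum _ fun b _ => ?_
    refine Measurable.ite ?_ measurable_const measurable_const
    exact measurableSet_lt (by fun_prop) (by fun_prop)
  exact measurableSet_le measurable_const h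

lemma rankBelow_comp {B : ℕ} (x : Fin B → ℝ) (π : Equiv.Perm (Fin B)) (c : Fin B) :
    rankBelow (x ∘ π) c = rankBelow x (π c) :=
  Finset.card_equiv π fun i => by simp

/-- Near a point that has no tie with its coordinate `c`, the rank of that coordinate is
constant. -/
lemma frontier_le_rankBelow_subset {B : ℕ} (r : ℕ) (c : Fin B) :
    frontier {x : EuclideanSpace ℝ (Fin B) | r ≤ rankBelow x c} ⊆
      ⋃ b ∈ {b : Fin B | b ≠ c}, {x | x b = x c} := by
  intro x hx
  by_contra hne
  simp only [Set.mem_iUnion, not_exists] at hne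
  have hloc : ∀ᶠ y : EuclideanSpace ℝ (Fin B) in 𝓝 x, rankBelow y c = rankBelow x c := by
    have : ∀ᶠ y : EuclideanSpace ℝ (Fin B) in 𝓝 x, ∀ b, (y b < y c ↔ x b < x c) := by
      refine eventually_all.2 fun b => ?_
      have hb : Tendsto (fun y : EuclideanSpace ℝ (Fin B) => y b) (𝓝 x) (𝓝 (x b)) :=
        (by fun_prop : Continuous fun y : EuclideanSpace ℝ (Fin B) => y b).tendsto x
      have hc : Tendsto (fun y : EuclideanSpace ℝ (Fin B) => y c) (𝓝 x) (𝓝 (x c)) :=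
        (by fun_prop : Continuous fun y : EuclideanSpace ℝ (Fin B) => y c).tendsto x
      by_cases hbc : b = c
      · subst hbc; simp
      rcases lt_or_gt_of_ne (show x b ≠ x c from hne b hbc) with h | h
      · filter_upwards [hb.eventually_lt hc h] with y hy using by simp [hy, h]
      · filter_upwards [hc.eventually_lt hb h] with y hy using by simp [hy.not_gt, h.not_gt]
    filter_upwards [this] with y hy
    simp only [rankBelow, hy]
  rw [frontier_eq_closure_inter_closure] at hx
  have h1 := (mem_closure_iff_frequently.1 hx.1).and_eventually hloc
  have h2 := (mem_closure_iff_frequently.1 hx.2).and_eventually hloc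
  obtain ⟨y, hy, hy'⟩ := h1.exists
  obtain ⟨z, hz, hz'⟩ := h2.exists
  have hy : r ≤ rankBelow y c := hy
  have hz : ¬ r ≤ rankBelow z c := hz
  omega

/-! ### Exchangeable laws without ties -/

/-- Under an exchangeable law without ties all coordinates have the same rank distribution, and
exactly `B - r` of them have at least `r` coordinates below them. -/
lemma measureReal_le_rankBelow {B : ℕ} (ν : Measure (EuclideanSpace ℝ (Fin B)))
    [IsProbabilityMeasure ν]
    (hex : ∀ (π : Equiv.Perm (Fin B)) (t : EuclideanSpace ℝ (Fin B)),
      charFun ν (WithLp.toLp 2 (t ∘ π)) = charFun ν t)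
    (hties : ∀ b c : Fin B, b ≠ c → ν {x : EuclideanSpace ℝ (Fin B) | x b = x c} = 0) {r : ℕ}
    (hr : r ≤ B) (a : Fin B) :
    ν.real {x | r ≤ rankBelow x a} = ((B : ℝ) - r) / B := by
  have hperm : ∀ π : Equiv.Perm (Fin B),
      ν.map (fun x : EuclideanSpace ℝ (Fin B) => WithLp.toLp 2 (x ∘ π)) = ν := by
    intro π
    have hm : Measurable fun x : EuclideanSpace ℝ (Fin B) => WithLp.toLp 2 (x ∘ π) := by
      refine (WithLp.measurable_toLp 2 _).comp (measurable_pi_lambda _ fun b => ?_)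
      simp only [Function.comp_apply]; fun_prop
    have := Measure.isProbabilityMeasure_map (μ := ν) hm.aemeasurable
    refine Measure.ext_of_charFun (funext fun t => ?_)
    rw [← hex π.symm t, charFun_apply, charFun_apply, integral_map hm.aemeasurable
      (by fun_prop)]
    congr with x
    congr 3
    simp only [PiLp.inner_apply, Function.comp_apply]
    exact Fintype.sum_equiv π _ _ fun b => by simp
  have hmeas := measurableSet_le_rankBelow (B := B) r
  have hsame : ∀ c, ν.real {x | r ≤ rankBelow x c} = ν.real {x | r ≤ rankBelow x a} := by
    intro c
    have hm : Measurable fun x : EuclideanSpace ℝ (Fin B) =>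
        WithLp.toLp 2 (x ∘ Equiv.swap a c) := by
      refine (WithLp.measurable_toLp 2 _).comp (measurable_pi_lambda _ fun b => ?_)
      simp only [Function.comp_apply]; fun_prop
    conv_rhs => rw [← hperm (Equiv.swap a c)]
    rw [map_measureReal_apply hm (hmeas a)]
    congr 1
    ext x
    change _ ↔ r ≤ rankBelow (x ∘ Equiv.swap a c) a
    rw [rankBelow_comp, Equiv.swap_apply_left]
    rfl
  have hinj : ∀ᵐ x : EuclideanSpace ℝ (Fin B) ∂ν, Function.Injective x := by
    have : ∀ᵐ x : EuclideanSpace ℝ (Fin B) ∂ν, ∀ b c : Fin B, b ≠ c → x b ≠ x c := by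
      refine ae_all_iff.2 fun b => ae_all_iff.2 fun c => ?_
      by_cases hbc : b = c
      · simp [hbc]
      · have := hties b c hbc
        simp only [ne_eq, hbc, not_false_eq_true, true_imp_iff]
        rw [ae_iff]; simpa using this
    filter_upwards [this] with x hx b c hbc
    by_contra h
    exact hx b c h hbc
  have hsum : ∑ c, ν.real {x | r ≤ rankBelow x c} = (B : ℝ) - r := by
    have h1 : ∀ c, ν.real {x | r ≤ rankBelow x c}
        = ∫ x, {x : EuclideanSpace ℝ (Fin B) |
          r ≤ rankBelow x c}.indicator (fun _ => (1 : ℝ)) x ∂ν :=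
      fun c => by rw [integral_indicator (hmeas c)]; simp
    simp only [h1]
    rw [← integral_finsetSum _ fun c _ => (integrable_const _).indicator (hmeas c)]
    rw [integral_congr_ae (g := fun _ => (B : ℝ) - r)]
    · simp
    · filter_upwards [hinj] with x hx
      have h2 := card_rankBelow_ge hx r
      rw [Finset.card_filter] at h2
      have h3 : ((B - r : ℕ) : ℝ) = (B : ℝ) - r := Nat.cast_sub hr
      rw [← h3, ← h2]
      push_cast
      exact Finset.sum_congr rfl fun c _ => by simp [Set.indicator_apply]
  simp only [hsame, Finset.sum_const, Finset.card_univ, Fintype.card_fin, nsmul_eq_mul] at hsum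
  have hB : (B : ℝ) ≠ 0 := by
    have := a.pos
    positivity
  rw [eq_div_iff hB]; linarith

open Complex in
/-- A law whose characteristic function is small at all nonzero multiples of `w` gives little mass
to the hyperplane orthogonal to `w`: integrate the Fejér kernel `|∑_{k < m} exp (i k ⟪x, w⟫)|²`,
which is nonnegative, and equal to `m²` on the hyperplane. -/
lemma measureReal_inner_eq_zero_le {F : Type*} [NormedAddCommGroup F] [InnerProductSpace ℝ F]
    [MeasurableSpace F] [BorelSpace F] [SecondCountableTopology F] (ν : Measure F)
    [IsProbabilityMeasure ν] (w : F) {ε : ℝ} (hε : 0 ≤ ε)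
    (h : ∀ k : ℤ, k ≠ 0 → ‖charFun ν ((k : ℝ) • w)‖ ≤ ε) {m : ℕ} (hm : m ≠ 0) :
    ν.real {x | inner ℝ x w = 0} ≤ 1 / m + ε := by
  let e : ℤ → F → ℂ := fun k x => cexp ((k * inner ℝ x w : ℝ) * I)
  have hem : ∀ k, Measurable (e k) := fun k => by fun_prop
  have hei : ∀ k, Integrable (e k) ν := fun k =>
    Integrable.of_bound (hem k).aestronglyMeasurable 1 (.of_forall fun x => by
      simp only [e, norm_exp_ofReal_mul_I, le_refl])
  have hint : ∀ k, ∫ x, e k x ∂ν = charFun ν ((k : ℝ) • w) := fun k => by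
    rw [charFun_apply]
    simp only [e, inner_smul_right]
  have hker : ∀ x, ((‖∑ k ∈ Finset.range m, e k x‖ ^ 2 : ℝ) : ℂ)
      = ∑ k ∈ Finset.range m, ∑ l ∈ Finset.range m, e (k - l) x := fun x => by
    rw [ofReal_pow, ← mul_conj', map_sum, Finset.sum_mul_sum]
    refine Finset.sum_congr rfl fun k _ => Finset.sum_congr rfl fun l _ => ?_
    simp only [e]
    rw [← exp_conj, ← exp_add, map_mul, conj_I, conj_ofReal]
    congr 1
    push_cast
    ring
  have hS : MeasurableSet {x : F | inner ℝ x w = 0} :=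
    measurableSet_eq_fun (by fun_prop) measurable_const
  have hkm : Measurable fun x => ‖∑ k ∈ Finset.range m, e k x‖ ^ 2 := by fun_prop
  have hki : Integrable (fun x => ‖∑ k ∈ Finset.range m, e k x‖ ^ 2) ν := by
    refine Integrable.of_bound hkm.aestronglyMeasurable ((m : ℝ) ^ 2) (.of_forall fun x => ?_)
    rw [Real.norm_eq_abs, abs_of_nonneg (sq_nonneg _)]
    gcongr
    refine (norm_sum_le _ _).trans ?_
    simp only [e, norm_exp_ofReal_mul_I, Finset.sum_const, Finset.card_range, nsmul_eq_mul,
      mul_one, le_refl]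
  have h1 : (m : ℝ) ^ 2 * ν.real {x | inner ℝ x w = 0}
      ≤ ∫ x, ‖∑ k ∈ Finset.range m, e k x‖ ^ 2 ∂ν := by
    have : (m : ℝ) ^ 2 * ν.real {x | inner ℝ x w = 0}
        = ∫ x, {x : F | inner ℝ x w = 0}.indicator (fun _ => (m : ℝ) ^ 2) x ∂ν := by
      rw [integral_indicator hS]; simp [mul_comm]
    rw [this]
    refine integral_mono ((integrable_const _).indicator hS) hki fun x => ?_
    by_cases hx : inner ℝ x w = 0
    · rw [Set.indicator_of_mem (by exact hx)]
      simp [e, hx]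
    · rw [Set.indicator_of_notMem (by exact hx)]
      positivity
  have h2 : ((∫ x, ‖∑ k ∈ Finset.range m, e k x‖ ^ 2 ∂ν : ℝ) : ℂ)
      = ∑ k ∈ Finset.range m, ∑ l ∈ Finset.range m, charFun ν (((k - l : ℤ) : ℝ) • w) := by
    refine integral_complex_ofReal.symm.trans ?_
    simp only [hker]
    rw [integral_finsetSum _ fun k _ => integrable_finsetSum _ fun l _ => hei _]
    refine Finset.sum_congr rfl fun k _ => ?_
    rw [integral_finsetSum _ fun l _ => hei _]
    exact Finset.sum_congr rfl fun l _ => hint _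
  have h3 : ∫ x, ‖∑ k ∈ Finset.range m, e k x‖ ^ 2 ∂ν ≤ m * (1 + m * ε) := by
    calc _ ≤ ‖((∫ x, ‖∑ k ∈ Finset.range m, e k x‖ ^ 2 ∂ν : ℝ) : ℂ)‖ := by
          rw [norm_real]; exact le_abs_self _
      _ ≤ ∑ k ∈ Finset.range m, ∑ l ∈ Finset.range m, ((if k = l then 1 else 0) + ε) := by
          rw [h2]
          refine (norm_sum_le _ _).trans (Finset.sum_le_sum fun k _ => (norm_sum_le _ _).trans
            (Finset.sum_le_sum fun l _ => ?_))
          by_cases hkl : k = l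
          · subst hkl
            simp [hε]
          · rw [if_neg hkl, zero_add]
            exact h _ (sub_ne_zero.2 (by exact_mod_cast hkl))
      _ ≤ ∑ k ∈ Finset.range m, (1 + m * ε) := by
          refine Finset.sum_le_sum fun k hk => ?_
          rw [Finset.sum_add_distrib, Finset.sum_ite_eq, if_pos hk]
          simp
      _ = _ := by simp [mul_add]
  have hm' : (0 : ℝ) < m := by positivity
  have h4 := h1.trans h3
  have h5 : (m : ℝ) * (m * ν.real {x | inner ℝ x w = 0}) ≤ m * (1 + m * ε) := by linarith
  have h6 := le_of_mul_le_mul_left h5 hm'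
  rw [div_add' _ _ _ hm'.ne', le_div_iff₀ hm']
  linarith

/-! ### Convergence of rank probabilities -/

/-- Prokhorov's theorem, with tightness from bounded second moments. -/
lemma exists_subseq_tendsto_of_lintegral_norm_sq_le {B : ℕ}
    (μ : ℕ → ProbabilityMeasure (EuclideanSpace ℝ (Fin B))) {C : ℝ≥0∞} (hC : C ≠ ∞)
    (h : ∀ᶠ n in atTop, ∫⁻ x, ‖x‖ₑ ^ 2 ∂(μ n : Measure (EuclideanSpace ℝ (Fin B))) ≤ C) :
    ∃ (ν : ProbabilityMeasure (EuclideanSpace ℝ (Fin B))) (ms : ℕ → ℕ),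
      StrictMono ms ∧ Tendsto (fun n => μ (ms n)) atTop (𝓝 ν) := by
  have htight : IsTightMeasureSet
      (Set.range fun n => (μ n : Measure (EuclideanSpace ℝ (Fin B)))) := by
    refine isTightMeasureSet_range_of_tendsto_limsup_measure_norm_gt ?_
    have hlim : Tendsto (fun r : ℝ => C / ENNReal.ofReal r ^ 2) atTop (𝓝 0) := by
      have h1 : Tendsto (fun r : ℝ => ENNReal.ofReal r ^ 2) atTop (𝓝 ∞) := by
        have h2 := ENNReal.tendsto_ofReal_atTop
        have h3 := (ENNReal.continuous_pow 2).tendsto ∞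
        rw [ENNReal.top_pow two_ne_zero] at h3
        exact h3.comp h2
      have h4 := ENNReal.Tendsto.const_div h1 (a := C) (Or.inr hC)
      simpa using h4
    refine tendsto_of_tendsto_of_tendsto_of_le_of_le' tendsto_const_nhds hlim
      (.of_forall fun _ => zero_le) ?_
    filter_upwards [eventually_gt_atTop 0] with r hr
    refine limsup_le_of_le (by isBoundedDefault) ?_
    filter_upwards [h] with n hn
    have hr' : 0 < ENNReal.ofReal r := ENNReal.ofReal_pos.2 hr
    rw [ENNReal.le_div_iff_mul_le (Or.inl (pow_ne_zero 2 hr'.ne'))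
      (Or.inl (ENNReal.pow_ne_top ENNReal.ofReal_ne_top)), mul_comm]
    refine le_trans (mul_le_mul_right (measure_mono fun x hx => ?_) _)
      ((mul_meas_ge_le_lintegral (by fun_prop) (ENNReal.ofReal r ^ 2)).trans hn)
    have hx : r < ‖x‖ := hx
    change ENNReal.ofReal r ^ 2 ≤ ‖x‖ₑ ^ 2
    gcongr
    rw [← ofReal_norm]
    exact ENNReal.ofReal_le_ofReal hx.le
  have hcomp : IsCompact (closure (Set.range μ)) := by
    refine isCompact_closure_of_isTightMeasureSet ?_
    convert htight using 1
    ext m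
    simp
  obtain ⟨ν, -, ms, hms, hlim⟩ :=
    hcomp.tendsto_subseq (x := μ) fun n => subset_closure (Set.mem_range_self n)
  exact ⟨ν, ms, hms, hlim⟩

/-- If the laws `μ' n` are tight, asymptotically exchangeable and asymptotically without ties, and
`μ n` is asymptotically equivalent to `μ' n`, then the rank of each coordinate is asymptotically
uniform under `μ n`. No limit law of `μ' n` is needed: every subsequence has a further one
along which there is a limit, which is exchangeable and has no ties. -/
theorem tendsto_measureReal_le_rankBelow {B : ℕ}
    (μ μ' : ℕ → ProbabilityMeasure (EuclideanSpace ℝ (Fin B))) {C : ℝ≥0∞} (hC : C ≠ ∞)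
    (htight : ∀ᶠ n in atTop, ∫⁻ x, ‖x‖ₑ ^ 2 ∂(μ' n : Measure (EuclideanSpace ℝ (Fin B))) ≤ C)
    (hclose : ∀ t, Tendsto (fun n => charFun (μ n : Measure (EuclideanSpace ℝ (Fin B))) t
      - charFun (μ' n : Measure (EuclideanSpace ℝ (Fin B))) t) atTop (𝓝 0))
    (hex : ∀ (π : Equiv.Perm (Fin B)) (t : EuclideanSpace ℝ (Fin B)),
      Tendsto (fun n => charFun (μ' n : Measure (EuclideanSpace ℝ (Fin B))) (WithLp.toLp 2 (t ∘ π))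
        - charFun (μ' n : Measure (EuclideanSpace ℝ (Fin B))) t) atTop (𝓝 0))
    (hties : ∀ b c : Fin B, b ≠ c → ∀ ε > (0 : ℝ), ∃ T : ℝ, 0 < T ∧ ∀ τ : ℝ, T ≤ |τ| →
      ∀ᶠ n in atTop, ‖charFun (μ' n : Measure (EuclideanSpace ℝ (Fin B)))
        (τ • (EuclideanSpace.single b 1 - EuclideanSpace.single c 1))‖ ≤ ε)
    {r : ℕ} (hr : r ≤ B) (a : Fin B) :
    Tendsto (fun n => (μ n : Measure (EuclideanSpace ℝ (Fin B))).real {x | r ≤ rankBelow x a})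
      atTop (𝓝 (((B : ℝ) - r) / B)) := by
  refine tendsto_of_subseq_tendsto fun ns hns => ?_
  obtain ⟨ν, ms, hms, hlim⟩ := exists_subseq_tendsto_of_lintegral_norm_sq_le (fun n => μ' (ns n)) hC
    (hns.eventually htight)
  refine ⟨ms, ?_⟩
  have hsub : Tendsto (fun n => ns (ms n)) atTop atTop := hns.comp hms.tendsto_atTop
  have hcf' := ProbabilityMeasure.tendsto_iff_tendsto_charFun.1 hlim
  have hlim2 : Tendsto (fun n => μ (ns (ms n))) atTop (𝓝 ν) := by
    refine ProbabilityMeasure.tendsto_iff_tendsto_charFun.2 fun t => ?_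
    have := ((hclose t).comp hsub).add (hcf' t)
    simpa using this
  have hexν : ∀ (π : Equiv.Perm (Fin B)) (t : EuclideanSpace ℝ (Fin B)),
      charFun (ν : Measure (EuclideanSpace ℝ (Fin B))) (WithLp.toLp 2 (t ∘ π))
        = charFun (ν : Measure (EuclideanSpace ℝ (Fin B))) t := fun π t =>
    sub_eq_zero.1 (tendsto_nhds_unique ((hcf' _).sub (hcf' t)) ((hex π t).comp hsub))
  have htiesν : ∀ b c : Fin B, b ≠ c →
      (ν : Measure (EuclideanSpace ℝ (Fin B))) {x : EuclideanSpace ℝ (Fin B) | x b = x c} = 0 := by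
    intro b c hbc
    have hle : ∀ ε > (0 : ℝ), (ν : Measure (EuclideanSpace ℝ (Fin B))).real
        {x : EuclideanSpace ℝ (Fin B) | x b = x c} ≤ ε := by
      intro ε hε
      obtain ⟨m, hm⟩ := exists_nat_one_div_lt (half_pos hε)
      obtain ⟨T, hT0, hT⟩ := hties b c hbc (ε / 2) (half_pos hε)
      let w : EuclideanSpace ℝ (Fin B) :=
        T • (EuclideanSpace.single b 1 - EuclideanSpace.single c 1)
      have h1 := measureReal_inner_eq_zero_le (ν : Measure (EuclideanSpace ℝ (Fin B))) w
        (half_pos hε).le (fun k hk => by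
          rw [smul_smul]
          refine le_of_tendsto ((hcf' _).norm) (hsub.eventually (hT (k * T) ?_))
          rw [abs_mul, abs_of_pos hT0]
          have : (1 : ℝ) ≤ |(k : ℝ)| := by exact_mod_cast Int.one_le_abs hk
          nlinarith) (Nat.succ_ne_zero m)
      have h2 : {x : EuclideanSpace ℝ (Fin B) | inner ℝ x w = 0}
          = {x : EuclideanSpace ℝ (Fin B) | x b = x c} := by
        ext x
        simp [w, inner_smul_right, inner_sub_right, EuclideanSpace.inner_single_right, hT0.ne',
          sub_eq_zero]
      rw [h2] at h1
      push_cast at h1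
      linarith
    have h3 := le_of_forall_pos_le_add (b := (0 : ℝ)) (fun ε hε => by simpa using hle ε hε)
    exact (measureReal_eq_zero_iff).1 (le_antisymm h3 measureReal_nonneg)
  rw [← measureReal_le_rankBelow (ν : Measure (EuclideanSpace ℝ (Fin B))) hexν htiesν hr a]
  have hfr : (ν : Measure (EuclideanSpace ℝ (Fin B)))
      (frontier {x : EuclideanSpace ℝ (Fin B) | r ≤ rankBelow x a}) = 0 := by
    refine measure_mono_null (frontier_le_rankBelow_subset r a) ?_
    exact (measure_biUnion_null_iff (Set.to_countable _)).2 fun b hb => htiesν b a hb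
  have := ProbabilityMeasure.tendsto_measure_of_null_frontier_of_tendsto' hlim2 hfr
  exact (ENNReal.tendsto_toReal (measure_ne_top _ _)).comp this

/-! ### The effective score without matrix square roots -/

section ScoreWeight

variable {N : ℕ} {size : Fin N → ℕ} {q : ℕ}

/-- The vector `W x - W Z (Zᵀ W Z)⁻¹ Zᵀ W x`, where `W` is block diagonal. The contribution of a
cluster to the effective score is its inner product with the residuals of that cluster. -/
noncomputable def scoreWeight (W : ∀ j, Matrix (Fin (size j)) (Fin (size j)) ℝ) (x : Obs size → ℝ)
    (Z : Matrix (Obs size) (Fin q) ℝ) : Obs size → ℝ :=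
  Matrix.blockDiagonal' W *ᵥ x
    - (Matrix.blockDiagonal' W * Z * (weightedGram W Z)⁻¹ * Zᵀ * Matrix.blockDiagonal' W) *ᵥ x

lemma weightSqrt_mul_self {W : ∀ j, Matrix (Fin (size j)) (Fin (size j)) ℝ}
    (hW : ∀ j, (W j).PosDef) : weightSqrt W * weightSqrt W = Matrix.blockDiagonal' W := by
  rw [weightSqrt, ← Matrix.blockDiagonal'_mul]
  congr 1
  funext j
  exact CFC.sqrt_mul_sqrt_self (W j) (hW j).posSemidef.nonneg

lemma blockDiagonal'_mulVec_apply (M : ∀ j, Matrix (Fin (size j)) (Fin (size j)) ℝ)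
    (v : Obs size → ℝ) (j : Fin N) (i : Fin (size j)) :
    (Matrix.blockDiagonal' M *ᵥ v) ⟨j, i⟩ = ∑ k, M j i k * v ⟨j, k⟩ := by
  rw [Matrix.mulVec, dotProduct, Fintype.sum_sigma, Finset.sum_eq_single j]
  · simp only [Matrix.blockDiagonal'_apply_eq]
  · intro j' _ hj'
    refine Finset.sum_eq_zero fun k _ => ?_
    rw [Matrix.blockDiagonal'_apply_ne _ _ _ hj'.symm, zero_mul]
  · simp

lemma cfc_sqrt_apply_comm {n : ℕ} (A : Matrix (Fin n) (Fin n) ℝ) (i k : Fin n) :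
    CFC.sqrt A i k = CFC.sqrt A k i := by
  have h : (CFC.sqrt A).IsHermitian := (CFC.sqrt_nonneg A).posSemidef.isHermitian
  simpa using h.apply k i

lemma scoreContribution_eq_sum (β₀ : ℝ) {W : ∀ j, Matrix (Fin (size j)) (Fin (size j)) ℝ}
    (hW : ∀ j, (W j).PosDef) (x : Obs size → ℝ) (Z : Matrix (Obs size) (Fin q) ℝ)
    (y : Obs size → ℝ) (γ : Fin q → ℝ) (j : Fin N) :
    scoreContribution β₀ W x Z y γ j
      = ∑ i, scoreWeight W x Z ⟨j, i⟩ * (y ⟨j, i⟩ - fittedMean β₀ x Z γ ⟨j, i⟩) := by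
  have h1 : scoreWeight W x Z = weightSqrt W *ᵥ ((1 - hatMatrix W Z) *ᵥ (weightSqrt W *ᵥ x)) := by
    rw [scoreWeight, Matrix.mulVec_mulVec, Matrix.mulVec_mulVec, ← Matrix.sub_mulVec]
    congr 1
    rw [Matrix.mul_sub, Matrix.sub_mul, Matrix.mul_one, hatMatrix, ← weightSqrt_mul_self hW]
    simp only [Matrix.mul_assoc]
  rw [h1, scoreContribution, dotProduct]
  simp only [weightSqrt, blockDiagonal'_mulVec_apply, Finset.mul_sum, Finset.sum_mul]
  rw [Finset.sum_comm]
  refine Finset.sum_congr rfl fun i _ => Finset.sum_congr rfl fun k _ => ?_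
  rw [cfc_sqrt_apply_comm (W j) i k, Pi.sub_apply]
  ring

end ScoreWeight

/-! ### Measurability of matrix expressions -/

section MatrixMeasurability

variable {Ω : Type*} {mΩ : MeasurableSpace Ω} {l m n : Type*}

lemma measurable_matrix_mul [Fintype m] {A : Ω → Matrix l m ℝ} {B : Ω → Matrix m n ℝ}
    (hA : ∀ i j, Measurable fun ω => A ω i j) (hB : ∀ i j, Measurable fun ω => B ω i j)
    (i : l) (j : n) : Measurable fun ω => (A ω * B ω) i j := by
  simp only [Matrix.mul_apply]
  exact Finset.measurable_fun_sum _ fun k _ => (hA i k).mul (hB k j)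

lemma measurable_matrix_mulVec [Fintype m] {A : Ω → Matrix l m ℝ} {v : Ω → m → ℝ}
    (hA : ∀ i j, Measurable fun ω => A ω i j) (hv : ∀ j, Measurable fun ω => v ω j)
    (i : l) : Measurable fun ω => (A ω *ᵥ v ω) i := by
  simp only [Matrix.mulVec, dotProduct]
  exact Finset.measurable_fun_sum _ fun k _ => (hA i k).mul (hv k)

lemma measurable_matrix_det [Fintype n] [DecidableEq n] {A : Ω → Matrix n n ℝ}
    (hA : ∀ i j, Measurable fun ω => A ω i j) : Measurable fun ω => (A ω).det := by
  simp only [Matrix.det_apply]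
  exact Finset.measurable_fun_sum _ fun π _ =>
    (Finset.measurable_fun_prod _ fun i _ => hA _ _).const_smul _

lemma measurable_matrix_inv [Fintype n] [DecidableEq n] {A : Ω → Matrix n n ℝ}
    (hA : ∀ i j, Measurable fun ω => A ω i j) (i j : n) : Measurable fun ω => (A ω)⁻¹ i j := by
  simp only [Matrix.inv_def, Ring.inverse_eq_inv', Matrix.smul_apply, smul_eq_mul,
    Matrix.adjugate_apply]
  refine (measurable_matrix_det hA).inv.mul (measurable_matrix_det fun k l => ?_)
  by_cases h : k = j
  · subst h; simp
  · simpa [Matrix.updateRow_ne h] using hA k l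

lemma measurable_blockDiagonal' {N : ℕ} {size : Fin N → ℕ}
    {W : Ω → ∀ j, Matrix (Fin (size j)) (Fin (size j)) ℝ}
    (hW : ∀ j a b, Measurable fun ω => W ω j a b) (i k : Obs size) :
    Measurable fun ω => Matrix.blockDiagonal' (W ω) i k := by
  obtain ⟨i, a⟩ := i
  obtain ⟨k, b⟩ := k
  by_cases h : i = k
  · subst h; simpa using hW i a b
  · simp [Matrix.blockDiagonal'_apply_ne _ _ _ h]

variable {N : ℕ} {size : Fin N → ℕ} {q : ℕ}
  {W : Ω → ∀ j, Matrix (Fin (size j)) (Fin (size j)) ℝ} {x : Ω → Obs size → ℝ}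
  {Z : Ω → Matrix (Obs size) (Fin q) ℝ} {y : Ω → Obs size → ℝ}

lemma measurable_weightedGram (hW : ∀ j a b, Measurable fun ω => W ω j a b)
    (hZ : ∀ i c, Measurable fun ω => Z ω i c) (c d : Fin q) :
    Measurable fun ω => weightedGram (W ω) (Z ω) c d :=
  measurable_matrix_mul (measurable_matrix_mul (fun i j => by simpa using hZ j i)
    (measurable_blockDiagonal' hW)) hZ c d

lemma measurable_scoreWeight (hW : ∀ j a b, Measurable fun ω => W ω j a b)
    (hx : ∀ i, Measurable fun ω => x ω i) (hZ : ∀ i c, Measurable fun ω => Z ω i c)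
    (i : Obs size) : Measurable fun ω => scoreWeight (W ω) (x ω) (Z ω) i := by
  have hbd := measurable_blockDiagonal' hW
  refine (measurable_matrix_mulVec hbd hx i).sub (measurable_matrix_mulVec ?_ hx i)
  refine measurable_matrix_mul (measurable_matrix_mul (measurable_matrix_mul
    (measurable_matrix_mul hbd hZ) ?_) fun i j => by simpa using hZ j i) hbd
  exact measurable_matrix_inv (measurable_weightedGram hW hZ)

lemma measurable_fittedMean (β₀ : ℝ) {γ : Ω → Fin q → ℝ} (hγ : ∀ c, Measurable fun ω => γ ω c)
    (hx : ∀ i, Measurable fun ω => x ω i) (hZ : ∀ i c, Measurable fun ω => Z ω i c)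
    (i : Obs size) : Measurable fun ω => fittedMean β₀ (x ω) (Z ω) (γ ω) i :=
  ((hx i).const_mul β₀).add (measurable_matrix_mulVec hZ hγ i)

lemma measurable_gammaHat (β₀ : ℝ) (hW : ∀ j a b, Measurable fun ω => W ω j a b)
    (hx : ∀ i, Measurable fun ω => x ω i) (hZ : ∀ i c, Measurable fun ω => Z ω i c)
    (hy : ∀ i, Measurable fun ω => y ω i) (c : Fin q) :
    Measurable fun ω => gammaHat β₀ (W ω) (x ω) (Z ω) (y ω) c := by
  refine measurable_matrix_mulVec (measurable_matrix_inv (measurable_weightedGram hW hZ))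
    (fun d => ?_) c
  refine measurable_matrix_mulVec (fun i j => by simpa using hZ j i) (fun i => ?_) d
  refine measurable_matrix_mulVec (measurable_blockDiagonal' hW) (fun k => ?_) i
  exact (hy k).sub ((hx k).const_mul β₀)

lemma measurable_scoreContribution (β₀ : ℝ) (hpos : ∀ ω j, (W ω j).PosDef)
    (hW : ∀ j a b, Measurable fun ω => W ω j a b)
    (hx : ∀ i, Measurable fun ω => x ω i) (hZ : ∀ i c, Measurable fun ω => Z ω i c)
    {j : Fin N} (hy : ∀ i, Measurable fun ω => y ω ⟨j, i⟩)
    {γ : Ω → Fin q → ℝ} (hγ : ∀ c, Measurable fun ω => γ ω c) :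
    Measurable fun ω => scoreContribution β₀ (W ω) (x ω) (Z ω) (y ω) (γ ω) j := by
  simp only [scoreContribution_eq_sum β₀ (hpos _)]
  exact Finset.measurable_fun_sum _ fun i _ => (measurable_scoreWeight hW hx hZ _).mul
    ((hy i).sub (measurable_fittedMean β₀ hγ hx hZ _))

end MatrixMeasurability

/-! ### Conditional laws given independent further information -/

section CondDistrib

variable {Ω 𝓓 𝓡 𝓣 𝓨 : Type*} [mΩ : MeasurableSpace Ω] [m𝓓 : MeasurableSpace 𝓓]
  [m𝓡 : MeasurableSpace 𝓡] [m𝓣 : MeasurableSpace 𝓣] [MeasurableSpace 𝓨] [StandardBorelSpace 𝓨]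
  [Nonempty 𝓨] {P : Measure Ω} [IsProbabilityMeasure P] {D : Ω → 𝓓} {R : Ω → 𝓡} {Y : Ω → 𝓨}

/-- If `(D, Y)` is independent of `R`, then the conditional law of `Y` given `(D, R)` is that
given `D`. -/
lemma condDistrib_prodMk_of_indepFun (hD : Measurable D) (hR : Measurable R) (hY : Measurable Y)
    (hind : IndepFun (fun ω => (D ω, Y ω)) R P) :
    condDistrib Y (fun ω => (D ω, R ω)) P =ᵐ[P.map fun ω => (D ω, R ω)]
      (condDistrib Y D P).prodMkRight 𝓡 := by
  refine condDistrib_ae_eq_of_measure_eq_compProd _ hY.aemeasurable ?_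
  have hDR : IndepFun D R P := hind.comp measurable_fst measurable_id
  have h1 := (indepFun_iff_map_prod_eq_prod_map_map (hD.prodMk hY).aemeasurable
    hR.aemeasurable).1 hind
  have h2 := (indepFun_iff_map_prod_eq_prod_map_map hD.aemeasurable hR.aemeasurable).1 hDR
  have h3 := compProd_map_condDistrib (mβ := m𝓓) (μ := P) (X := D) hY.aemeasurable
  have := Measure.isProbabilityMeasure_map (μ := P) hD.aemeasurable
  have := Measure.isProbabilityMeasure_map (μ := P) hR.aemeasurable
  refine Measure.ext_of_lintegral _ fun f hf => ?_
  have e1 : ∫⁻ z, f z ∂(P.map fun ω => ((D ω, R ω), Y ω))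
      = ∫⁻ z, f ((z.1.1, z.2), z.1.2) ∂(P.map fun ω => ((D ω, Y ω), R ω)) := by
    rw [lintegral_map hf (by fun_prop), lintegral_map (by fun_prop) (by fun_prop)]
  rw [e1, h1, ← h3, h2, lintegral_prod_symm' _ (by fun_prop), Measure.lintegral_compProd hf,
    lintegral_prod_symm' _ (Measurable.lintegral_kernel_prod_right' hf)]
  refine lintegral_congr fun r => ?_
  rw [Measure.lintegral_compProd (by fun_prop)]
  rfl

/-- If `(D, Y)` is independent of `R`, where `D` is a function of `T`, and `T` a function of
`(D, R)`, then the conditional expectations of a function of `(T, Y)` given `(D, R)` and given `T`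
agree, and are given by the conditional law of `Y` given `D`. -/
lemma condExp_of_indepFun (hD : Measurable D) (hR : Measurable R) (hY : Measurable Y)
    (hind : IndepFun (fun ω => (D ω, Y ω)) R P) {T : Ω → 𝓣} {p : 𝓣 → 𝓓} {g : 𝓓 × 𝓡 → 𝓣}
    (hp : Measurable p) (hg : Measurable g) (hpT : ∀ ω, p (T ω) = D ω)
    (hgT : ∀ ω, g (D ω, R ω) = T ω) {Ψ : 𝓣 × 𝓨 → ℝ} (hΨ : Measurable Ψ)
    (hi : Integrable (fun ω => Ψ (T ω, Y ω)) P) :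
    P[fun ω => Ψ (T ω, Y ω) | MeasurableSpace.comap (fun ω => (D ω, R ω)) inferInstance] =ᵐ[P]
        (fun ω => ∫ y, Ψ (T ω, y) ∂(condDistrib Y D P (D ω))) ∧
    P[fun ω => Ψ (T ω, Y ω) | MeasurableSpace.comap T inferInstance] =ᵐ[P]
        (fun ω => ∫ y, Ψ (T ω, y) ∂(condDistrib Y D P (D ω))) := by
  have hX : Measurable fun ω => (D ω, R ω) := hD.prodMk hR
  have hTm : Measurable T := by
    rw [show T = g ∘ fun ω => (D ω, R ω) from funext fun ω => (hgT ω).symm]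
    exact hg.comp hX
  have h1 : P[fun ω => Ψ (T ω, Y ω) | MeasurableSpace.comap (fun ω => (D ω, R ω)) inferInstance]
      =ᵐ[P] (fun ω => ∫ y, Ψ (T ω, y) ∂(condDistrib Y D P (D ω))) := by
    have h2 := condExp_prod_ae_eq_integral_condDistrib (μ := P) hX hY.aemeasurable
      (f := fun z : (𝓓 × 𝓡) × 𝓨 => Ψ (g z.1, z.2)) (by fun_prop : Measurable _).stronglyMeasurable
      (by simpa only [hgT] using hi)
    simp only [hgT] at h2
    refine h2.trans ?_
    filter_upwards [ae_of_ae_map hX.aemeasurable (condDistrib_prodMk_of_indepFun hD hR hY hind)]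
      with ω hω
    rw [hω]
    rfl
  refine ⟨h1, ?_⟩
  have hle : MeasurableSpace.comap T inferInstance
      ≤ MeasurableSpace.comap (fun ω => (D ω, R ω)) inferInstance := by
    rw [show T = g ∘ fun ω => (D ω, R ω) from funext fun ω => (hgT ω).symm,
      ← MeasurableSpace.comap_comp]
    exact MeasurableSpace.comap_mono hg.comap_le
  have h3 := condExp_condExp_of_le (μ := P) (f := fun ω => Ψ (T ω, Y ω)) hle hX.comap_le
  refine h3.symm.trans ((condExp_congr_ae h1).trans ?_)
  have hsm : StronglyMeasurable fun t => ∫ y, Ψ (t, y) ∂((condDistrib Y D P).comap p hp t) :=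
    StronglyMeasurable.integral_kernel_prod_right' hΨ.stronglyMeasurable
  have hsT : StronglyMeasurable[MeasurableSpace.comap T inferInstance]
      fun ω => ∫ y, Ψ (T ω, y) ∂(condDistrib Y D P (D ω)) := by
    have := hsm.comp_measurable (comap_measurable T)
    simp only [Kernel.comap_apply, Function.comp_def, hpT] at this
    exact this
  rw [condExp_of_stronglyMeasurable hTm.comap_le hsT]
  exact (integrable_condExp (μ := P)).congr h1

end CondDistrib

/-! ### The score contributions of an experiment -/

namespace ClusterExperiment

variable {q B : ℕ} {E : ClusterExperiment.{u} q B} {β₀ : ℝ} {γ : Fin q → ℝ}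

lemma designSigma_eq_comap (E : ClusterExperiment.{u} q B) :
    E.designSigma = MeasurableSpace.comap (fun ω k => E.clusterCovariates k ω) inferInstance := by
  change _ = MeasurableSpace.comap _ MeasurableSpace.pi
  rw [MeasurableSpace.pi, MeasurableSpace.comap_iSup]
  simp only [MeasurableSpace.comap_comp]
  rfl

lemma measurable_x_of_covariates {m : MeasurableSpace E.Ω}
    (h : ∀ j, Measurable[m] (E.clusterCovariates j)) (i : Obs E.size) :
    Measurable[m] fun ω => E.x ω i :=
  (measurable_pi_apply i.2).comp (measurable_fst.comp (h i.1))

lemma measurable_Z_of_covariates {m : MeasurableSpace E.Ω}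
    (h : ∀ j, Measurable[m] (E.clusterCovariates j)) (i : Obs E.size) (c : Fin q) :
    Measurable[m] fun ω => E.Z ω i c :=
  (measurable_pi_apply c).comp ((measurable_pi_apply i.2).comp (measurable_snd.comp (h i.1)))

lemma measurable_clusterCovariates_designSigma (j : Fin E.N) :
    Measurable[E.designSigma] (E.clusterCovariates j) :=
  (comap_measurable _).mono (le_iSup E.clusterSigma j) le_rfl

namespace DataConditions

lemma measurable_clusterData (hd : E.DataConditions) (j : Fin E.N) :
    Measurable (E.clusterData j) :=
  (measurable_pi_apply j).comp (measurable_fst.comp hd.measurable_observed)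

lemma measurable_clusterCovariates (hd : E.DataConditions) (j : Fin E.N) :
    Measurable (E.clusterCovariates j) :=
  measurable_fst.comp (hd.measurable_clusterData j)

lemma measurable_y (hd : E.DataConditions) (i : Obs E.size) : Measurable fun ω => E.y ω i :=
  (measurable_pi_apply i.2).comp (measurable_snd.comp (hd.measurable_clusterData i.1))

lemma measurable_What (hd : E.DataConditions) (j : Fin E.N) (a b : Fin (E.size j)) :
    Measurable fun ω => E.What ω j a b :=
  (measurable_pi_apply b).comp ((measurable_pi_apply a).comp ((measurable_pi_apply j).comp
    (measurable_snd.comp hd.measurable_observed)))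

lemma designSigma_le (hd : E.DataConditions) : E.designSigma ≤ E.mΩ :=
  iSup_le fun j => (hd.measurable_clusterCovariates j).comap_le

lemma measurable_zetaStar_of_le (hd : E.DataConditions) {m : MeasurableSpace E.Ω}
    (hm : E.designSigma ≤ m) {j : Fin E.N} (hy : ∀ i, Measurable[m] fun ω => E.y ω ⟨j, i⟩) :
    Measurable[m] (E.zetaStar β₀ γ j) := by
  have hc : ∀ j, Measurable[m] (E.clusterCovariates j) := fun j =>
    (measurable_clusterCovariates_designSigma j).mono hm le_rfl
  exact measurable_scoreContribution β₀ hd.posDef_W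
    (fun j a b => (hd.measurable_W j a b).mono hm le_rfl) (measurable_x_of_covariates hc)
    (measurable_Z_of_covariates hc) hy (fun c => measurable_const)

lemma measurable_zetaStar (hd : E.DataConditions) (j : Fin E.N) :
    Measurable (E.zetaStar β₀ γ j) :=
  hd.measurable_zetaStar_of_le hd.designSigma_le fun _ => hd.measurable_y _

lemma measurable_zetaHat (hd : E.DataConditions) (j : Fin E.N) :
    Measurable (E.zetaHat β₀ j) :=
  measurable_scoreContribution β₀ hd.posDef_What hd.measurable_What
    (measurable_x_of_covariates hd.measurable_clusterCovariates)
    (measurable_Z_of_covariates hd.measurable_clusterCovariates) (fun _ => hd.measurable_y _)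
    (measurable_gammaHat β₀ hd.measurable_What
      (measurable_x_of_covariates hd.measurable_clusterCovariates)
      (measurable_Z_of_covariates hd.measurable_clusterCovariates) hd.measurable_y)

/-- The score contributions at the true parameter are functions of the data, hence independent of
the signs. -/
lemma measurable_zetaStar_observed (hd : E.DataConditions) (j : Fin E.N) :
    Measurable[MeasurableSpace.comap E.observed inferInstance] (E.zetaStar β₀ γ j) := by
  have hobs : Measurable[MeasurableSpace.comap E.observed inferInstance] E.observed :=
    comap_measurable _
  have hdata : ∀ k, Measurable[MeasurableSpace.comap E.observed inferInstance] (E.clusterData k) :=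
    fun k => (measurable_pi_apply k).comp (measurable_fst.comp hobs)
  refine hd.measurable_zetaStar_of_le (iSup_le fun k => ?_) fun i =>
    (measurable_pi_apply i).comp (measurable_snd.comp (hdata j))
  exact (measurable_fst.comp (hdata k)).comap_le

/-- Given all covariates, the score contributions at the true parameter are independent and
centred: the responses of cluster `j` are centred given its covariates, and those and the weights
computed from all covariates are kept fixed when the data of the other clusters are given. -/
lemma exists_isCondCentredArray_zetaStar (hd : E.DataConditions) (hm : E.MeanModel β₀ γ)
    (hint : ∀ j, Integrable (E.zetaStar β₀ γ j) E.P) :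
    ∃ 𝓗 : Fin E.N → MeasurableSpace E.Ω,
      IsCondCentredArray E.designSigma 𝓗 E.P (E.zetaStar β₀ γ) := by
  classical
  have := hd.isProbabilityMeasure
  let T : E.Ω → ∀ k, (Fin (E.size k) → ℝ) × (Fin (E.size k) → Fin q → ℝ) :=
    fun ω k => E.clusterCovariates k ω
  let R : ∀ j : Fin E.N, E.Ω → ∀ k : ({j}ᶜ : Finset (Fin E.N)),
      ((Fin (E.size k) → ℝ) × (Fin (E.size k) → Fin q → ℝ)) × (Fin (E.size k) → ℝ) :=
    fun j ω k => E.clusterData k ω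
  let Y : ∀ j : Fin E.N, E.Ω → Fin (E.size j) → ℝ := fun j ω i => E.y ω ⟨j, i⟩
  have hGT : E.designSigma = MeasurableSpace.comap T inferInstance := E.designSigma_eq_comap
  have hDm := hd.measurable_clusterCovariates
  have hRm : ∀ j, Measurable (R j) := fun j => measurable_pi_lambda _ fun k =>
    hd.measurable_clusterData k
  have hYm : ∀ j, Measurable (Y j) := fun j => measurable_pi_lambda _ fun i => hd.measurable_y _
  have hind : ∀ j, IndepFun (fun ω => (E.clusterCovariates j ω, Y j ω)) (R j) E.P := fun j => by
    have h1 := hd.indep_clusters.indepFun_finset {j} {j}ᶜ disjoint_compl_right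
      hd.measurable_clusterData
    exact h1.comp (measurable_pi_apply (⟨j, by simp⟩ : ({j} : Finset (Fin E.N)))) measurable_id
  -- weights and means are functions of the covariates
  have hcov : ∀ (f : E.Ω → ℝ), Measurable[E.designSigma] f → ∃ h, Measurable h ∧ f = h ∘ T := by
    intro f hf
    rw [hGT] at hf
    obtain ⟨h, h1, h2⟩ := hf.stronglyMeasurable.exists_eq_measurable_comp
    exact ⟨h, h1.measurable, h2⟩
  have hx := measurable_x_of_covariates (E := E) measurable_clusterCovariates_designSigma
  have hZ := measurable_Z_of_covariates (E := E) measurable_clusterCovariates_designSigma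
  have hA := fun i => hcov _ (measurable_scoreWeight hd.measurable_W hx hZ i)
  have hM := fun i => hcov _
    (measurable_fittedMean β₀ (fun c => measurable_const (a := γ c)) hx hZ i)
  choose A hAm hA using hA
  choose M hMm hM using hM
  let Ψ : ∀ j, (∀ k, (Fin (E.size k) → ℝ) × (Fin (E.size k) → Fin q → ℝ)) ×
      (Fin (E.size j) → ℝ) → ℝ :=
    fun j z => ∑ i, A ⟨j, i⟩ z.1 * (z.2 i - M ⟨j, i⟩ z.1)
  have hΨm : ∀ j, Measurable (Ψ j) := fun j => Finset.measurable_fun_sum _ fun i _ =>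
    ((hAm _).comp measurable_fst).mul
      (((measurable_pi_apply i).comp measurable_snd).sub ((hMm _).comp measurable_fst))
  have hζ : ∀ j ω, E.zetaStar β₀ γ j ω = Ψ j (T ω, Y j ω) := fun j ω => by
    rw [zetaStar, scoreContribution_eq_sum β₀ (hd.posDef_W ω)]
    refine Finset.sum_congr rfl fun i _ => ?_
    rw [show scoreWeight (E.W ω) (E.x ω) (E.Z ω) ⟨j, i⟩ = A ⟨j, i⟩ (T ω) from
      congrFun (hA ⟨j, i⟩) ω, show fittedMean β₀ (E.x ω) (E.Z ω) γ ⟨j, i⟩ = M ⟨j, i⟩ (T ω) from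
      congrFun (hM ⟨j, i⟩) ω]
  let g : ∀ j : Fin E.N, ((Fin (E.size j) → ℝ) × (Fin (E.size j) → Fin q → ℝ)) ×
      (∀ k : ({j}ᶜ : Finset (Fin E.N)),
        ((Fin (E.size k) → ℝ) × (Fin (E.size k) → Fin q → ℝ)) × (Fin (E.size k) → ℝ)) →
      ∀ k, (Fin (E.size k) → ℝ) × (Fin (E.size k) → Fin q → ℝ) :=
    fun j z k => if h : k = j then h ▸ z.1 else (z.2 ⟨k, by simpa using h⟩).1
  have hgm : ∀ j, Measurable (g j) := fun j => measurable_pi_lambda _ fun k => by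
    by_cases h : k = j
    · subst h
      simpa [g] using measurable_fst
    · simp only [g, dif_neg h]
      exact measurable_fst.comp ((measurable_pi_apply _).comp measurable_snd)
  have hgT : ∀ j ω, g j (E.clusterCovariates j ω, R j ω) = T ω := fun j ω => by
    funext k
    by_cases h : k = j
    · subst h; simp [g, T]
    · simp only [g, dif_neg h]; rfl
  have key : ∀ j (φ : ℝ → ℝ), Measurable φ → Integrable (fun ω => φ (E.zetaStar β₀ γ j ω)) E.P →
      _ := fun j φ hφ hi => condExp_of_indepFun (P := E.P) (hDm j) (hRm j) (hYm j) (hind j) (T := T)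
    (p := fun t => t j) (measurable_pi_apply j) (hgm j) (fun ω => rfl) (hgT j)
    (Ψ := φ ∘ Ψ j) (hφ.comp (hΨm j)) (by simpa only [hζ, Function.comp_apply] using hi)
  have hle : ∀ j, E.designSigma ≤ MeasurableSpace.comap
      (fun ω => (E.clusterCovariates j ω, R j ω)) inferInstance := fun j => by
    rw [hGT, show T = g j ∘ fun ω => (E.clusterCovariates j ω, R j ω) from
      funext fun ω => (hgT j ω).symm, ← MeasurableSpace.comap_comp]
    exact MeasurableSpace.comap_mono (hgm j).comap_le
  refine ⟨fun j => MeasurableSpace.comap (fun ω => (E.clusterCovariates j ω, R j ω)) inferInstance,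
    hle, fun j => ((hDm j).prodMk (hRm j)).comap_le, fun j k hkj => ?_, hint,
    hd.measurable_zetaStar, fun j => ?_, fun j φ hφ hi => ?_⟩
  · refine hd.measurable_zetaStar_of_le (hle j) fun i => ?_
    have h1 : Measurable[MeasurableSpace.comap (fun ω => (E.clusterCovariates j ω, R j ω))
        inferInstance] (fun ω => (E.clusterCovariates j ω, R j ω)) := comap_measurable _
    have h2 : Measurable[MeasurableSpace.comap (fun ω => (E.clusterCovariates j ω, R j ω))
        inferInstance] (E.clusterData k) :=
      (measurable_pi_apply (⟨k, by simpa using hkj⟩ : ({j}ᶜ : Finset (Fin E.N)))).comp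
        (measurable_snd.comp h1)
    exact (measurable_pi_apply i).comp (measurable_snd.comp h2)
  · have h1 := (key j id measurable_id (hint j)).2
    rw [← hGT] at h1
    simp only [Function.comp_apply, id, ← hζ] at h1
    refine h1.trans ?_
    have hmean : ∀ i, ∀ᵐ ω ∂E.P, Integrable (fun y : Fin (E.size j) → ℝ => y i)
          (condDistrib (Y j) (E.clusterCovariates j) E.P (E.clusterCovariates j ω)) ∧
        ∫ y, y i ∂(condDistrib (Y j) (E.clusterCovariates j) E.P (E.clusterCovariates j ω))
          = M ⟨j, i⟩ (T ω) := fun i => by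
      have h2 := condExp_ae_eq_integral_condDistrib (μ := E.P) (hDm j) (hYm j).aemeasurable
        (f := fun y => y i) (measurable_pi_apply i).stronglyMeasurable (hd.integrable_y ⟨j, i⟩)
      have h3 : ∀ᵐ ω ∂E.P, Integrable (fun y : Fin (E.size j) → ℝ => y i)
          (condDistrib (Y j) (E.clusterCovariates j) E.P (E.clusterCovariates j ω)) :=
        Integrable.condDistrib_ae (f := fun z : _ × (Fin (E.size j) → ℝ) => z.2 i)
          (hDm j).aemeasurable (hYm j).aemeasurable
          ((integrable_map_measure
            ((measurable_pi_apply i).comp measurable_snd).aestronglyMeasurable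
            ((hDm j).prodMk (hYm j)).aemeasurable).2 (hd.integrable_y ⟨j, i⟩))
      filter_upwards [h2, h3, hm j i] with ω h4 h5 h6
      refine ⟨h5, ?_⟩
      rw [← h4, show M ⟨j, i⟩ (T ω) = _ from (congrFun (hM ⟨j, i⟩) ω).symm]
      refine h6.trans ?_
      simp [fittedMean, mul_comm]
    filter_upwards [ae_all_iff.2 hmean] with ω hω
    have hi : ∀ i, Integrable (fun y : Fin (E.size j) → ℝ =>
        A ⟨j, i⟩ (T ω) * (y i - M ⟨j, i⟩ (T ω)))
        (condDistrib (Y j) (E.clusterCovariates j) E.P (E.clusterCovariates j ω)) := fun i =>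
      ((hω i).1.sub (integrable_const _)).const_mul _
    simp only [Ψ, Pi.zero_apply]
    rw [integral_finsetSum _ fun i _ => hi i]
    refine Finset.sum_eq_zero fun i _ => ?_
    rw [integral_const_mul, integral_sub (hω i).1 (integrable_const _), (hω i).2]
    simp
  · have h1 := key j φ hφ hi
    rw [← hGT] at h1
    simp only [Function.comp_apply, ← hζ] at h1
    exact h1.1.trans h1.2.symm

end DataConditions

end ClusterExperiment

/-! ### Sign-flipped sums -/

section Signs

variable {Ω : Type*} {N B : ℕ} {G : MeasurableSpace Ω} {𝓗 : Fin N → MeasurableSpace Ω}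
  [mΩ : MeasurableSpace Ω] {P : Measure Ω} [IsProbabilityMeasure P]

/-- The vector of sign-flipped sums `∑ j, s b j * v j`, `b = 1, …, B`. -/
noncomputable def flippedSum (s : Fin B → Fin N → ℝ) (v : Fin N → ℝ) : EuclideanSpace ℝ (Fin B) :=
  WithLp.toLp 2 fun b => ∑ j, s b j * v j

lemma measurable_flippedSum {s : Ω → Fin B → Fin N → ℝ} {v : Fin N → Ω → ℝ} (hs : Measurable s)
    (hv : ∀ j, Measurable (v j)) : Measurable fun ω => flippedSum (s ω) fun j => v j ω := by
  refine (WithLp.measurable_toLp 2 _).comp (measurable_pi_lambda _ fun b => ?_)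
  exact Finset.measurable_fun_sum _ fun j _ =>
    ((measurable_pi_apply j).comp ((measurable_pi_apply b).comp hs)).mul (hv j)

lemma ae_eq_one_or_eq_neg_one {X : Ω → ℝ} (hX : Measurable X) (h1 : P {ω | X ω = 1} = 1 / 2)
    (h2 : P {ω | X ω = -1} = 1 / 2) : ∀ᵐ ω ∂P, X ω = 1 ∨ X ω = -1 := by
  have hm1 : MeasurableSet {ω | X ω = 1} := measurableSet_eq_fun hX measurable_const
  have hm2 : MeasurableSet {ω | X ω = -1} := measurableSet_eq_fun hX measurable_const
  have hdisj : Disjoint {ω | X ω = 1} {ω | X ω = -1} := by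
    rw [Set.disjoint_left]
    intro ω (h : X ω = 1) (h' : X ω = -1)
    linarith
  have h3 : P ({ω | X ω = 1} ∪ {ω | X ω = -1}) = 1 := by
    rw [measure_union hdisj hm2, h1, h2, ENNReal.add_halves]
  exact (mem_ae_iff_prob_eq_one (hm1.union hm2)).2 h3

open Complex in
lemma integral_exp_sign_mul {X : Ω → ℝ} (hX : Measurable X) (h1 : P {ω | X ω = 1} = 1 / 2)
    (h2 : P {ω | X ω = -1} = 1 / 2) (c : ℝ) :
    ∫ ω, cexp ((c * X ω : ℝ) * I) ∂P = Real.cos c := by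
  have hm1 : MeasurableSet {ω | X ω = 1} := measurableSet_eq_fun hX measurable_const
  have hm2 : MeasurableSet {ω | X ω = -1} := measurableSet_eq_fun hX measurable_const
  have e : (fun ω => cexp ((c * X ω : ℝ) * I)) =ᵐ[P] fun ω =>
      {ω | X ω = 1}.indicator (fun _ => cexp (c * I)) ω
        + {ω | X ω = -1}.indicator (fun _ => cexp (-c * I)) ω := by
    filter_upwards [ae_eq_one_or_eq_neg_one hX h1 h2] with ω hω
    rcases hω with h | h
    · simp [Set.indicator_apply, h]
      norm_num
    · simp [Set.indicator_apply, h]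
      norm_num
  rw [integral_congr_ae e, integral_add ((integrable_const _).indicator hm1)
    ((integrable_const _).indicator hm2), integral_indicator hm1, integral_indicator hm2]
  simp only [integral_const, measureReal_def, Measure.restrict_apply_univ, h1, h2, ofReal_cos,
    Complex.cos]
  rw [← smul_add]
  norm_num [real_smul]
  ring

variable {s : Ω → Fin B → Fin N → ℝ} {v : Fin N → Ω → ℝ}

open Complex in
/-- The characteristic function of the vector of sign-flipped sums: the first one is not flipped,
and independent signs turn exponentials into cosines. -/
lemma charFun_map_flippedSum [NeZero B] (hs : Measurable s) (hv : ∀ j, Measurable (v j))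
    (hs0 : ∀ ω j, s ω 0 j = 1)
    (hpos : ∀ b, b ≠ 0 → ∀ j, P {ω | s ω b j = 1} = 1 / 2)
    (hneg : ∀ b, b ≠ 0 → ∀ j, P {ω | s ω b j = -1} = 1 / 2)
    (hsi : iIndepFun (fun (p : {b : Fin B // b ≠ 0} × Fin N) ω => s ω p.1 p.2) P)
    (hind : IndepFun (fun ω j => v j ω) s P) (t : EuclideanSpace ℝ (Fin B)) :
    charFun (P.map fun ω => flippedSum (s ω) fun j => v j ω) t
      = ∫ ω, ∏ j, (cexp ((t 0 * v j ω : ℝ) * I)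
          * (∏ b : {b : Fin B // b ≠ 0}, Real.cos (t b * v j ω) : ℝ)) ∂P := by
  have hvm : Measurable fun ω j => v j ω := measurable_pi_lambda _ hv
  have hsm : ∀ b j, Measurable fun ω => s ω b j := fun b j =>
    (measurable_pi_apply j).comp ((measurable_pi_apply b).comp hs)
  let F : (Fin N → ℝ) × (Fin B → Fin N → ℝ) → ℂ := fun z =>
    cexp ((∑ b, t b * ∑ j, z.2 b j * z.1 j : ℝ) * I)
  have hFm : Measurable F := by fun_prop
  have hinner : ∀ z : Fin N → ℝ, ∫ ω, F (z, s ω) ∂P = ∏ j, (cexp ((t 0 * z j : ℝ) * I)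
      * (∏ b : {b : Fin B // b ≠ 0}, Real.cos (t b * z j) : ℝ)) := by
    intro z
    have e1 : ∀ ω, F (z, s ω) = (∏ j, cexp ((t 0 * z j : ℝ) * I)) *
        ∏ p : {b : Fin B // b ≠ 0} × Fin N, cexp ((t p.1 * z p.2 * s ω p.1 p.2 : ℝ) * I) := by
      intro ω
      simp only [F]
      rw [← exp_sum, ← exp_sum, ← exp_add, ← Finset.sum_mul, ← Finset.sum_mul, ← add_mul,
        ← ofReal_sum, ← ofReal_sum, ← ofReal_add]
      congr 3
      rw [Fintype.sum_eq_add_sum_subtype_ne _ (0 : Fin B), Fintype.sum_prod_type]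
      simp only [hs0, one_mul, Finset.mul_sum]
      congr 1
      exact Finset.sum_congr rfl fun b _ => Finset.sum_congr rfl fun j _ => by ring
    simp only [e1]
    rw [integral_const_mul, hsi.integral_fun_prod_comp
      (f := fun p x => cexp ((t p.1 * z p.2 * x : ℝ) * I))
      (fun p => (hsm p.1 p.2).aemeasurable)
      (fun p => (by fun_prop : Measurable _).aestronglyMeasurable)]
    rw [Finset.prod_mul_distrib]
    congr 1
    rw [Fintype.prod_prod_type_right]
    refine Finset.prod_congr rfl fun j _ => ?_
    rw [ofReal_prod]
    exact Finset.prod_congr rfl fun b _ =>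
      integral_exp_sign_mul (hsm b j) (hpos b b.2 j) (hneg b b.2 j) _
  rw [charFun_apply, integral_map (measurable_flippedSum hs hv).aemeasurable (by fun_prop)]
  have e2 : ∀ ω, cexp (inner ℝ (flippedSum (s ω) fun j => v j ω) t * I)
      = F ((fun j => v j ω), s ω) := fun ω => by
    simp only [F, flippedSum, PiLp.inner_apply, RCLike.inner_apply, conj_trivial]
  simp only [e2]
  have h1 := (indepFun_iff_map_prod_eq_prod_map_map hvm.aemeasurable hs.aemeasurable).1 hind
  have hFi : Integrable F ((P.map fun ω j => v j ω).prod (P.map s)) := by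
    have := Measure.isProbabilityMeasure_map (μ := P) hvm.aemeasurable
    have := Measure.isProbabilityMeasure_map (μ := P) hs.aemeasurable
    exact Integrable.of_bound hFm.aestronglyMeasurable 1
      (.of_forall fun z => (norm_exp_ofReal_mul_I _).le)
  have := Measure.isProbabilityMeasure_map (μ := P) hs.aemeasurable
  rw [← integral_map (φ := fun ω => ((fun j => v j ω), s ω)) (hvm.prodMk hs).aemeasurable
    hFm.aestronglyMeasurable, h1, integral_prod _ hFi, integral_map hvm.aemeasurable]
  · refine integral_congr_ae (.of_forall fun ω => ?_)
    dsimp only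
    rw [integral_map hs.aemeasurable (by fun_prop)]
    exact hinner _
  · exact hFi.aestronglyMeasurable.integral_prod_right'

lemma lintegral_norm_flippedSum_sq_le (hv : IsCondCentredArray G 𝓗 P v)
    (hL : ∀ j, MemLp (v j) 2 P) (hs : Measurable s)
    (hs1 : ∀ᵐ ω ∂P, ∀ b j, |s ω b j| ≤ 1) (hind : IndepFun (fun ω j => v j ω) s P) :
    ∫⁻ ω, ‖flippedSum (s ω) fun j => v j ω‖ₑ ^ 2 ∂P
      ≤ ENNReal.ofReal (B * ∑ j, ∫ ω, v j ω ^ 2 ∂P) := by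
  have hsm : ∀ b j, Measurable fun ω => s ω b j := fun b j =>
    (measurable_pi_apply j).comp ((measurable_pi_apply b).comp hs)
  have hss : ∀ b j k, ∀ᵐ ω ∂P, |s ω b j * s ω b k| ≤ 1 := fun b j k => by
    filter_upwards [hs1] with ω hω
    rw [abs_mul]
    exact mul_le_one₀ (hω b j) (abs_nonneg _) (hω b k)
  have hvv : ∀ j k, Integrable (fun ω => v j ω * v k ω) P := fun j k =>
    (hL j).integrable_mul (hL k)
  have hint : ∀ b j k, Integrable (fun ω => (s ω b j * s ω b k) * (v j ω * v k ω)) P :=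
    fun b j k => (hvv j k).bdd_mul ((hsm b j).mul (hsm b k)).aestronglyMeasurable (hss b j k)
  have e1 : ∀ ω, ‖flippedSum (s ω) fun j => v j ω‖ ^ 2
      = ∑ b, ∑ j, ∑ k, (s ω b j * s ω b k) * (v j ω * v k ω) := fun ω => by
    rw [EuclideanSpace.real_norm_sq_eq]
    refine Finset.sum_congr rfl fun b _ => ?_
    simp only [flippedSum]
    rw [sq, Finset.sum_mul_sum]
    exact Finset.sum_congr rfl fun j _ => Finset.sum_congr rfl fun k _ => by ring
  have hi : Integrable (fun ω => ‖flippedSum (s ω) fun j => v j ω‖ ^ 2) P := by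
    simp only [e1]
    exact integrable_finsetSum _ fun b _ => integrable_finsetSum _ fun j _ =>
      integrable_finsetSum _ fun k _ => hint b j k
  have e2 : ∀ ω, ‖flippedSum (s ω) fun j => v j ω‖ₑ ^ 2
      = ENNReal.ofReal (‖flippedSum (s ω) fun j => v j ω‖ ^ 2) := fun ω => by
    rw [ENNReal.ofReal_pow (norm_nonneg _), ofReal_norm]
  simp only [e2]
  rw [← ofReal_integral_eq_lintegral_ofReal hi (.of_forall fun ω => sq_nonneg _)]
  refine ENNReal.ofReal_le_ofReal ?_
  simp only [e1]
  rw [integral_finsetSum _ fun b _ => integrable_finsetSum _ fun j _ =>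
      integrable_finsetSum _ fun k _ => hint b j k]
  calc _ ≤ ∑ b : Fin B, ∑ j, ∫ ω, v j ω ^ 2 ∂P := by
        refine Finset.sum_le_sum fun b _ => ?_
        rw [integral_finsetSum _ fun j _ => integrable_finsetSum _ fun k _ => hint b j k]
        refine Finset.sum_le_sum fun j _ => ?_
        rw [integral_finsetSum _ fun k _ => hint b j k, Finset.sum_eq_single j]
        · refine integral_mono_ae (hint b j j) (hL j).integrable_sq ?_
          filter_upwards [hss b j j] with ω hω
          have h0 : 0 ≤ v j ω ^ 2 := sq_nonneg _
          have := (abs_le.1 hω).2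
          nlinarith
        · intro k _ hkj
          have h2 : IndepFun (fun ω => v j ω * v k ω) (fun ω => s ω b j * s ω b k) P :=
            hind.comp (φ := fun z : Fin N → ℝ => z j * z k)
              (ψ := fun σ : Fin B → Fin N → ℝ => σ b j * σ b k)
              (by fun_prop) (by fun_prop)
          have h3 := h2.integral_fun_mul_eq_mul_integral
            ((hv.measurable j).mul (hv.measurable k)).aestronglyMeasurable
            ((hsm b j).mul (hsm b k)).aestronglyMeasurable
          rw [hv.integral_mul_eq_zero hkj hL, zero_mul] at h3
          rw [← h3]
          exact integral_congr_ae (.of_forall fun ω => mul_comm _ _)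
        · simp
    _ = _ := by simp

open Complex in
lemma norm_charFun_flippedSum_sub_le {v' : Fin N → Ω → ℝ} (hs : Measurable s)
    (hv : ∀ j, Measurable (v j)) (hv' : ∀ j, Measurable (v' j))
    (hs1 : ∀ᵐ ω ∂P, ∀ b j, |s ω b j| ≤ 1) (t : EuclideanSpace ℝ (Fin B)) {ε : ℝ} (hε : 0 ≤ ε) :
    ‖charFun (P.map fun ω => flippedSum (s ω) fun j => v' j ω) t
      - charFun (P.map fun ω => flippedSum (s ω) fun j => v j ω) t‖
      ≤ (∑ b, |t b|) * ε + 2 * P.real {ω | ε < ∑ j, |v' j ω - v j ω|} := by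
  have hm := measurable_flippedSum hs hv
  have hm' := measurable_flippedSum hs hv'
  have hexp : ∀ u : EuclideanSpace ℝ (Fin B), ‖cexp (inner ℝ u t * I)‖ = 1 := fun u =>
    norm_exp_ofReal_mul_I _
  have hce : ∀ {f : Ω → EuclideanSpace ℝ (Fin B)}, Measurable f →
      Integrable (fun ω => cexp (inner ℝ (f ω) t * I)) P := fun {f} hf =>
    Integrable.of_bound (by fun_prop) 1 (.of_forall fun ω => (hexp _).le)
  rw [charFun_apply, charFun_apply, integral_map hm'.aemeasurable (by fun_prop),
    integral_map hm.aemeasurable (by fun_prop), ← integral_sub (hce hm') (hce hm)]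
  have hS : MeasurableSet {ω | ε < ∑ j, |v' j ω - v j ω|} :=
    measurableSet_lt measurable_const (Finset.measurable_fun_sum _ fun j _ =>
      measurable_abs.comp ((hv' j).sub (hv j)))
  have hSi : Integrable ({ω | ε < ∑ j, |v' j ω - v j ω|}.indicator fun _ => (2 : ℝ)) P :=
    (integrable_const _).indicator hS
  have hT : 0 ≤ ∑ b, |t b| := Finset.sum_nonneg fun b _ => abs_nonneg _
  refine (norm_integral_le_of_norm_le (g := fun ω => (∑ b, |t b|) * ε +
    {ω | ε < ∑ j, |v' j ω - v j ω|}.indicator (fun _ => (2 : ℝ)) ω)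
    ((integrable_const _).add hSi) ?_).trans_eq ?_
  · filter_upwards [hs1] with ω hω
    by_cases h : ε < ∑ j, |v' j ω - v j ω|
    · rw [Set.indicator_of_mem (by exact h)]
      have h1 := norm_sub_le (cexp (inner ℝ (flippedSum (s ω) fun j => v' j ω) t * I))
        (cexp (inner ℝ (flippedSum (s ω) fun j => v j ω) t * I))
      rw [hexp, hexp] at h1
      have : 0 ≤ (∑ b, |t b|) * ε := by positivity
      linarith
    · rw [Set.indicator_of_notMem (by exact h), add_zero]
      have h1 : ∀ x y : ℝ, ‖cexp (x * I) - cexp (y * I)‖ ≤ |x - y| := fun x y => by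
        have e : cexp (x * I) - cexp (y * I) = cexp (y * I) * (cexp (I * (x - y : ℝ)) - 1) := by
          rw [mul_sub, ← exp_add, mul_one]
          congr 2
          push_cast
          ring
        rw [e, norm_mul, norm_exp_ofReal_mul_I, one_mul]
        exact Real.norm_exp_I_mul_ofReal_sub_one_le
      refine (h1 _ _).trans ?_
      rw [← inner_sub_left, PiLp.inner_apply, Finset.sum_mul]
      refine (Finset.abs_sum_le_sum_abs _ _).trans (Finset.sum_le_sum fun b _ => ?_)
      simp only [flippedSum, RCLike.inner_apply, conj_trivial, abs_mul, PiLp.sub_apply]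
      gcongr
      rw [← Finset.sum_sub_distrib]
      refine (Finset.abs_sum_le_sum_abs _ _).trans (le_trans (Finset.sum_le_sum fun j _ => ?_)
        (not_lt.1 h))
      rw [← mul_sub, abs_mul]
      exact mul_le_of_le_one_left (abs_nonneg _) (hω b j)
  · rw [integral_add (integrable_const _) hSi, integral_indicator hS]
    simp [mul_comm]

end Signs

/-! ### Asymptotics of the scaled score contributions -/

namespace ClusterExperiment

variable {q B : ℕ} {E : ClusterExperiment.{u} q B} {β₀ : ℝ} {γ : Fin q → ℝ}

/-- The factor `n^{-1/2}`. -/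
noncomputable def scale (E : ClusterExperiment.{u} q B) : ℝ := (E.total : ℝ) ^ (-(1 / 2) : ℝ)

lemma scale_nonneg : 0 ≤ E.scale := by unfold scale; positivity

lemma scale_eq : E.scale = (√(E.total : ℝ))⁻¹ := by
  rw [scale, Real.rpow_neg (Nat.cast_nonneg _), Real.sqrt_eq_rpow]

lemma scale_sq : E.scale ^ 2 = (E.total : ℝ)⁻¹ := by
  rw [scale_eq, inv_pow, Real.sq_sqrt (Nat.cast_nonneg _)]

namespace SignConditions

variable [NeZero B]

lemma ae_abs_sign_le_one (hd : E.DataConditions) (hs : E.SignConditions) :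
    ∀ᵐ ω ∂E.P, ∀ b j, |E.sign ω b j| ≤ 1 := by
  have := hd.isProbabilityMeasure
  refine ae_all_iff.2 fun b => ae_all_iff.2 fun j => ?_
  by_cases hb : b = 0
  · subst hb
    exact .of_forall fun ω => by rw [hs.sign_first]; simp
  · have hm : Measurable fun ω => E.sign ω b j :=
      (measurable_pi_apply j).comp ((measurable_pi_apply b).comp hs.measurable_sign)
    filter_upwards [ae_eq_one_or_eq_neg_one hm (hs.prob_pos b hb j) (hs.prob_neg b hb j)] with ω hω
    rcases hω with h | h <;> simp [h]

lemma indepFun_zetaStar_sign (hd : E.DataConditions) (hs : E.SignConditions) :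
    IndepFun (fun ω j => E.scale * E.zetaStar β₀ γ j ω) E.sign E.P := by
  rw [IndepFun_iff_Indep]
  refine indep_of_indep_of_le_left ((IndepFun_iff_Indep _ _ _).1 hs.indep_data) ?_
  refine Measurable.comap_le ?_
  exact @measurable_pi_lambda _ _ _ (MeasurableSpace.comap E.observed inferInstance) _ _
    fun j => (hd.measurable_zetaStar_observed j).const_mul _

end SignConditions

lemma rejectionEvent_eq [NeZero B] {α : ℝ} (h1 : 1 ≤ ⌈(1 - α) * (B : ℝ)⌉₊)
    (h2 : ⌈(1 - α) * (B : ℝ)⌉₊ ≤ B) :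
    E.rejectionEvent β₀ α = (fun ω => flippedSum (E.sign ω) fun j => E.scale * E.zetaHat β₀ j ω) ⁻¹'
      {x | ⌈(1 - α) * (B : ℝ)⌉₊ ≤ rankBelow x 0} := by
  ext ω
  have e : ⇑(flippedSum (E.sign ω) fun j => E.scale * E.zetaHat β₀ j ω) = E.flippedScore β₀ ω := by
    funext b
    simp only [flippedSum, flippedScore, Finset.mul_sum, scale]
    exact Finset.sum_congr rfl fun j _ => by ring
  change orderStat (E.flippedScore β₀ ω) _ < E.flippedScore β₀ ω 0 ↔
    _ ≤ rankBelow (⇑(flippedSum (E.sign ω) _)) 0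
  rw [e, orderStat_lt_iff _ h1 h2]

end ClusterExperiment

section Asymptotics

open ClusterExperiment

variable {q B : ℕ} {E : ℕ → ClusterExperiment.{u} q B} {β₀ : ℝ} {γ : Fin q → ℝ}

/-- In the variance condition, real-valued variances carry no information unless the score
contributions are square integrable; this follows from the truncated second moments. -/
lemma eventually_memLp_zetaStar (hn : Tendsto (fun k => (E k).total) atTop atTop)
    (hdata : ∀ k, (E k).DataConditions) (hvar : VarianceCondition E β₀ γ) :
    ∀ᶠ k in atTop, ∀ j, MemLp ((E k).zetaStar β₀ γ j) 2 (E k).P := by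
  filter_upwards [(hvar.2 1 one_pos).eventually (gt_mem_nhds zero_lt_one),
    hn.eventually_ge_atTop 1] with k hk hk1 j
  have := (hdata k).isProbabilityMeasure
  have hm := (hdata k).measurable_zetaStar (β₀ := β₀) (γ := γ) j
  have hS : MeasurableSet {ω | 1 * √((E k).total : ℝ) < |(E k).zetaStar β₀ γ j ω|} :=
    measurableSet_lt measurable_const (measurable_abs.comp hm)
  have hfin : ∫⁻ ω in {ω | 1 * √((E k).total : ℝ) < |(E k).zetaStar β₀ γ j ω|},
      ‖(E k).zetaStar β₀ γ j ω‖ₑ ^ 2 ∂(E k).P ≠ ∞ := by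
    intro htop
    have h1 : ∑ j, ∫⁻ ω in {ω | 1 * √((E k).total : ℝ) < |(E k).zetaStar β₀ γ j ω|},
        ‖(E k).zetaStar β₀ γ j ω‖ₑ ^ 2 ∂(E k).P = ∞ :=
      ENNReal.sum_eq_top.2 ⟨j, Finset.mem_univ _, htop⟩
    rw [h1, ENNReal.mul_top (by simp)] at hk
    simp at hk
  have hcompl : ∫⁻ ω in {ω | 1 * √((E k).total : ℝ) < |(E k).zetaStar β₀ γ j ω|}ᶜ,
      ‖(E k).zetaStar β₀ γ j ω‖ₑ ^ 2 ∂(E k).P ≠ ∞ := by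
    refine ne_of_lt (lt_of_le_of_lt (setLIntegral_mono measurable_const
      (g := fun _ => ENNReal.ofReal √((E k).total : ℝ) ^ 2) fun ω hω => ?_) ?_)
    · have hω' : |(E k).zetaStar β₀ γ j ω| ≤ √((E k).total : ℝ) := by
        have : ¬ (1 * √((E k).total : ℝ) < |(E k).zetaStar β₀ γ j ω|) := hω
        linarith
      gcongr
      rw [← ofReal_norm]
      exact ENNReal.ofReal_le_ofReal hω'
    · rw [setLIntegral_const]
      exact ENNReal.mul_lt_top (ENNReal.pow_lt_top ENNReal.ofReal_lt_top) (measure_lt_top _ _)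
  refine ⟨hm.aestronglyMeasurable, ?_⟩
  rw [eLpNorm_lt_top_iff_lintegral_rpow_enorm_lt_top (by simp) (by simp)]
  simp only [ENNReal.toReal_ofNat, ENNReal.rpow_ofNat]
  rw [← lintegral_add_compl _ hS]
  exact ENNReal.add_lt_top.2 ⟨hfin.lt_top, hcompl.lt_top⟩

/-- For large `n` the scaled score contributions are square integrable and conditionally centred, so
that conditional variances are conditional second moments. -/
lemma eventually_isCondCentredArray (hn : Tendsto (fun k => (E k).total) atTop atTop)
    (hdata : ∀ k, (E k).DataConditions) (hmean : ∀ k, (E k).MeanModel β₀ γ)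
    (hvar : VarianceCondition E β₀ γ) :
    ∀ᶠ k in atTop, 0 < (E k).total ∧
      (∀ j, MemLp (fun ω => (E k).scale * (E k).zetaStar β₀ γ j ω) 2 (E k).P) ∧
      (∀ j, ∫ ω, (E k).zetaStar β₀ γ j ω ∂(E k).P = 0) ∧
      (∀ j, condVar (E k).designSigma ((E k).zetaStar β₀ γ j) (E k).P =ᵐ[(E k).P]
        (E k).P[fun ω => (E k).zetaStar β₀ γ j ω ^ 2 | (E k).designSigma]) ∧
      ∃ 𝓗 : Fin (E k).N → MeasurableSpace (E k).Ω,
        IsCondCentredArray (E k).designSigma 𝓗 (E k).P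
          fun j ω => (E k).scale * (E k).zetaStar β₀ γ j ω := by
  filter_upwards [eventually_memLp_zetaStar hn hdata hvar, hn.eventually_ge_atTop 1] with k hk hk1
  have := (hdata k).isProbabilityMeasure
  obtain ⟨𝓗, h𝓗⟩ := (hdata k).exists_isCondCentredArray_zetaStar (hmean k)
    fun j => (hk j).integrable one_le_two
  refine ⟨hk1, fun j => (hk j).const_mul _, fun j => ?_, fun j => ?_, 𝓗, h𝓗.const_mul _⟩
  · rw [← integral_condExp (hdata k).designSigma_le, integral_eq_zero_of_ae (h𝓗.condExp_eq_zero j)]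
  · refine condExp_congr_ae ?_
    filter_upwards [h𝓗.condExp_eq_zero j] with ω hω
    simp [hω]

lemma eventually_sum_integral_sq_le (hn : Tendsto (fun k => (E k).total) atTop atTop)
    (hdata : ∀ k, (E k).DataConditions) (hmean : ∀ k, (E k).MeanModel β₀ γ)
    (hvar : VarianceCondition E β₀ γ) : ∃ C : ℝ, 0 < C ∧ ∀ᶠ k in atTop,
      ∑ j, ∫ ω, ((E k).scale * (E k).zetaStar β₀ γ j ω) ^ 2 ∂(E k).P ≤ C := by
  obtain ⟨σsq, hσ, hlim⟩ := hvar.1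
  refine ⟨σsq + 1, by linarith, ?_⟩
  filter_upwards [eventually_isCondCentredArray hn hdata hmean hvar,
    hlim.eventually (gt_mem_nhds (lt_add_one σsq))] with k hk hk2
  refine le_trans (le_of_eq ?_) hk2.le
  rw [Finset.mul_sum]
  refine Finset.sum_congr rfl fun j _ => ?_
  rw [variance_of_integral_eq_zero ((hdata k).measurable_zetaStar j).aemeasurable (hk.2.2.1 j),
    ← integral_const_mul]
  simp only [mul_pow, scale_sq]

lemma tendsto_sum_setIntegral_sq (hn : Tendsto (fun k => (E k).total) atTop atTop)
    (hdata : ∀ k, (E k).DataConditions) (hvar : VarianceCondition E β₀ γ) {τ : ℝ} (hτ : 0 < τ) :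
    Tendsto (fun k => ∑ j, ∫ ω in {ω | τ < |(E k).scale * (E k).zetaStar β₀ γ j ω|},
      ((E k).scale * (E k).zetaStar β₀ γ j ω) ^ 2 ∂(E k).P) atTop (𝓝 0) := by
  have h1 := (ENNReal.tendsto_toReal ENNReal.zero_ne_top).comp (hvar.2 τ hτ)
  refine h1.congr' ?_
  filter_upwards [eventually_memLp_zetaStar hn hdata hvar, hn.eventually_ge_atTop 1] with k hk hk1
  have hpos : (0 : ℝ) < √((E k).total : ℝ) := Real.sqrt_pos.2 (by exact_mod_cast hk1)
  have hset : ∀ j, {ω | τ < |(E k).scale * (E k).zetaStar β₀ γ j ω|}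
      = {ω | τ * √((E k).total : ℝ) < |(E k).zetaStar β₀ γ j ω|} := fun j => by
    ext ω
    change τ < _ ↔ τ * _ < _
    rw [abs_mul, abs_of_nonneg scale_nonneg, scale_eq, inv_mul_eq_div, lt_div_iff₀ hpos]
  have hint : ∀ j, ∫ ω in {ω | τ * √((E k).total : ℝ) < |(E k).zetaStar β₀ γ j ω|},
      (E k).zetaStar β₀ γ j ω ^ 2 ∂(E k).P
      = (∫⁻ ω in {ω | τ * √((E k).total : ℝ) < |(E k).zetaStar β₀ γ j ω|},
        ‖(E k).zetaStar β₀ γ j ω‖ₑ ^ 2 ∂(E k).P).toReal := fun j => by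
    rw [integral_eq_lintegral_of_nonneg_ae (.of_forall fun ω => sq_nonneg _)
      (((hdata k).measurable_zetaStar j).pow_const 2).aestronglyMeasurable]
    congr 1
    refine lintegral_congr fun ω => ?_
    rw [← sq_abs, ENNReal.ofReal_pow (abs_nonneg _), ← Real.norm_eq_abs, ofReal_norm]
  have hfin : ∀ j, ∫⁻ ω in {ω | τ * √((E k).total : ℝ) < |(E k).zetaStar β₀ γ j ω|},
        ‖(E k).zetaStar β₀ γ j ω‖ₑ ^ 2 ∂(E k).P ≠ ∞ := fun j => by
    have h2 := (eLpNorm_lt_top_iff_lintegral_rpow_enorm_lt_top (by simp) (by simp)).1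
      (hk j).eLpNorm_lt_top
    simp only [ENNReal.toReal_ofNat, ENNReal.rpow_ofNat] at h2
    exact ((setLIntegral_le_lintegral _ _).trans_lt h2).ne
  simp only [Function.comp_apply, ENNReal.toReal_mul, ENNReal.toReal_inv, ENNReal.toReal_natCast]
  rw [ENNReal.toReal_sum fun j _ => hfin j, Finset.mul_sum]
  refine Finset.sum_congr rfl fun j _ => ?_
  rw [hset, ← hint]
  simp only [mul_pow, scale_sq]
  rw [integral_const_mul]

lemma eventually_measureReal_sum_condExp_sq_lt (hn : Tendsto (fun k => (E k).total) atTop atTop)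
    (hdata : ∀ k, (E k).DataConditions) (hmean : ∀ k, (E k).MeanModel β₀ γ)
    (hvar : VarianceCondition E β₀ γ) (hcond : ConditionallyNondegenerate E β₀ γ) {ε : ℝ}
    (hε : 0 < ε) : ∃ δ > (0 : ℝ), ∀ᶠ k in atTop, (E k).P.real {ω | ∑ j,
      ((E k).P[fun ω => ((E k).scale * (E k).zetaStar β₀ γ j ω) ^ 2 | (E k).designSigma]) ω < δ}
        ≤ ε := by
  obtain ⟨δ, hδ, hk⟩ := hcond ε hε
  refine ⟨δ, hδ, ?_⟩
  filter_upwards [eventually_isCondCentredArray hn hdata hmean hvar, hk] with k hk1 hk2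
  have := (hdata k).isProbabilityMeasure
  refine ENNReal.toReal_le_of_le_ofReal hε.le (le_trans (measure_mono_ae ?_) hk2)
  have h1 : ∀ j, (E k).P[fun ω => ((E k).scale * (E k).zetaStar β₀ γ j ω) ^ 2 | (E k).designSigma]
      =ᵐ[(E k).P] fun ω => ((E k).total : ℝ)⁻¹ *
        (condVar (E k).designSigma ((E k).zetaStar β₀ γ j) (E k).P) ω := fun j => by
    have h2 := condExp_smul (μ := (E k).P) ((E k).total : ℝ)⁻¹
      (fun ω => (E k).zetaStar β₀ γ j ω ^ 2) (E k).designSigma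
    have h3 : (fun ω => ((E k).scale * (E k).zetaStar β₀ γ j ω) ^ 2)
        = ((E k).total : ℝ)⁻¹ • fun ω => (E k).zetaStar β₀ γ j ω ^ 2 := by
      funext ω
      simp only [mul_pow, scale_sq, Pi.smul_apply, smul_eq_mul]
    rw [h3]
    filter_upwards [h2, hk1.2.2.2.1 j] with ω h4 h5
    rw [h4, h5]
    rfl
  filter_upwards [ae_all_iff.2 h1] with ω hω h4
  have h4' : ∑ j, ((E k).P[fun ω => ((E k).scale * (E k).zetaStar β₀ γ j ω) ^ 2 |
    (E k).designSigma]) ω < δ := h4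
  change _ * _ < δ
  rw [Finset.mul_sum]
  simpa only [hω] using h4'

end Asymptotics

/-! ### Limits of the characteristic functions of the flipped scores -/

section Limit

open ClusterExperiment

variable {q B : ℕ} {E : ℕ → ClusterExperiment.{u} q B} {β₀ : ℝ} {γ : Fin q → ℝ}

/-- The real and symmetric function of `t` that the characteristic function of the flipped scores
approaches: `E ∏ j, ∏ b, cos (t b * v j)`, where `v j` is the scaled score contribution of cluster
`j`. It is the characteristic function that the scores would have if all `B` rows of signs were
random. -/
noncomputable def prodCosMean (E : ClusterExperiment.{u} q B) (β₀ : ℝ) (γ : Fin q → ℝ)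
    (t : EuclideanSpace ℝ (Fin B)) : ℝ :=
  ∫ ω, ∏ j, ∏ b, Real.cos (t b * (E.scale * E.zetaStar β₀ γ j ω)) ∂E.P

lemma prodCosMean_comp_perm (E : ClusterExperiment.{u} q B) (t : EuclideanSpace ℝ (Fin B))
    (π : Equiv.Perm (Fin B)) :
    prodCosMean E β₀ γ (WithLp.toLp 2 (t ∘ π)) = prodCosMean E β₀ γ t := by
  unfold prodCosMean
  congr with ω
  refine Finset.prod_congr rfl fun j _ => ?_
  exact Equiv.prod_comp π fun b => Real.cos (t b * (E.scale * E.zetaStar β₀ γ j ω))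

lemma prodCosMean_smul_single_sub_single (E : ClusterExperiment.{u} q B) {b c : Fin B}
    (hbc : b ≠ c) (τ : ℝ) :
    prodCosMean E β₀ γ (τ • (EuclideanSpace.single b (1 : ℝ) - EuclideanSpace.single c 1))
      = ∫ ω, ∏ j, Real.cos (τ * (E.scale * E.zetaStar β₀ γ j ω)) ^ 2 ∂E.P := by
  unfold prodCosMean
  refine integral_congr_ae (.of_forall fun ω => Finset.prod_congr rfl fun j _ => ?_)
  rw [Fintype.prod_eq_mul b c hbc]
  · simp [hbc, hbc.symm, sq]
  · rintro a ⟨hab, hac⟩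
    simp [hab, hac]

/-- The law of the flipped scores computed from the score contributions `ζ`. -/
noncomputable def flippedLaw (E : ClusterExperiment.{u} q B) (ζ : Fin E.N → E.Ω → ℝ) :
    Measure (EuclideanSpace ℝ (Fin B)) :=
  E.P.map fun ω => flippedSum (E.sign ω) fun j => E.scale * ζ j ω

variable [NeZero B]

/-- Asymptotic exchangeability of the scores at the true nuisance parameter. -/
lemma tendsto_charFun_flippedLaw_sub (hn : Tendsto (fun k => (E k).total) atTop atTop)
    (hdata : ∀ k, (E k).DataConditions) (hsign : ∀ k, (E k).SignConditions)
    (hmean : ∀ k, (E k).MeanModel β₀ γ) (hvar : VarianceCondition E β₀ γ)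
    (t : EuclideanSpace ℝ (Fin B)) :
    Tendsto (fun k => charFun (flippedLaw (E k) ((E k).zetaStar β₀ γ)) t
      - (prodCosMean (E k) β₀ γ t : ℂ)) atTop (𝓝 0) := by
  obtain ⟨C, hC, hCk⟩ := eventually_sum_integral_sq_le hn hdata hmean hvar
  let M : ℝ := |t 0| * (t 0 ^ 2 + ∑ b : {b : Fin B // b ≠ 0}, t b ^ 2)
  have hM : 0 ≤ M := by positivity
  rw [Metric.tendsto_nhds]
  intro ε hε
  -- the truncation level that makes the cubic error smaller than `ε / 2`
  let τ : ℝ := ε / (2 * (M * C + 1))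
  have hτ : 0 < τ := by positivity
  have hMτ : M * τ * C < ε / 2 := by
    have h1 : M * τ * C = M * C / (M * C + 1) * (ε / 2) := by
      simp only [τ]; field_simp
    have h2 : M * C / (M * C + 1) < 1 := by
      rw [div_lt_one (by positivity)]; linarith
    rw [h1]
    have : 0 < ε / 2 := by positivity
    nlinarith
  have hL := (tendsto_sum_setIntegral_sq (β₀ := β₀) (γ := γ) hn hdata hvar hτ).const_mul
    (2 * |t 0| / τ)
  rw [mul_zero] at hL
  filter_upwards [eventually_isCondCentredArray hn hdata hmean hvar, hCk,
    hL.eventually (gt_mem_nhds (half_pos hε))] with k hk hC1 hL1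
  have := (hdata k).isProbabilityMeasure
  obtain ⟨-, hmem, -, -, 𝓗, h𝓗⟩ := hk
  have h1 := h𝓗.norm_integral_prod_exp_sub_prod_cos_le hmem
    (Finset.univ : Finset {b : Fin B // b ≠ 0}) (fun b => t b) (t 0) hτ
  have hs := hsign k
  rw [flippedLaw, charFun_map_flippedSum hs.measurable_sign
    (fun j => ((hdata k).measurable_zetaStar j).const_mul _) hs.sign_first hs.prob_pos hs.prob_neg
    hs.indep_signs (SignConditions.indepFun_zetaStar_sign (hdata k) hs), dist_zero_right]
  have e : prodCosMean (E k) β₀ γ t = ∫ ω, ∏ j, (Real.cos (t 0 * ((E k).scale *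
      (E k).zetaStar β₀ γ j ω)) * ∏ b : {b : Fin B // b ≠ 0},
      Real.cos (t b * ((E k).scale * (E k).zetaStar β₀ γ j ω))) ∂(E k).P := by
    unfold prodCosMean
    congr with ω
    exact Finset.prod_congr rfl fun j _ => Fintype.prod_eq_mul_prod_subtype_ne _ 0
  rw [e]
  refine h1.trans_lt ?_
  have h2 : M * τ * ∑ j, ∫ ω, ((E k).scale * (E k).zetaStar β₀ γ j ω) ^ 2 ∂(E k).P
      ≤ M * τ * C := by gcongr
  change M * τ * _ + _ < ε
  linarith

/-- No ties in the limit: the characteristic function of the difference of two flipped scores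
is eventually small at large arguments. -/
lemma exists_forall_norm_charFun_flippedLaw_le (hn : Tendsto (fun k => (E k).total) atTop atTop)
    (hdata : ∀ k, (E k).DataConditions) (hsign : ∀ k, (E k).SignConditions)
    (hmean : ∀ k, (E k).MeanModel β₀ γ) (hvar : VarianceCondition E β₀ γ)
    (hcond : ConditionallyNondegenerate E β₀ γ) {b c : Fin B} (hbc : b ≠ c) {ε : ℝ} (hε : 0 < ε) :
    ∃ T : ℝ, 0 < T ∧ ∀ τ : ℝ, T ≤ |τ| → ∀ᶠ k in atTop,
      ‖charFun (flippedLaw (E k) ((E k).zetaStar β₀ γ))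
        (τ • (EuclideanSpace.single b 1 - EuclideanSpace.single c 1))‖ ≤ ε := by
  have hε4 : 0 < ε / 4 := by positivity
  obtain ⟨δ, hδ, hδk⟩ := eventually_measureReal_sum_condExp_sq_lt hn hdata hmean hvar hcond hε4
  have hexp : Tendsto (fun T : ℝ => Real.exp (-(T ^ 2 * δ / 4))) atTop (𝓝 0) := by
    refine Real.tendsto_exp_neg_atTop_nhds_zero.comp ?_
    exact ((tendsto_pow_atTop two_ne_zero).atTop_mul_const hδ).atTop_div_const (by norm_num)
  obtain ⟨T, hT, hT0⟩ := ((hexp.eventually (gt_mem_nhds hε4)).and (eventually_gt_atTop 0)).exists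
  refine ⟨T, hT0, fun τ hτ => ?_⟩
  have hτ0 : 0 < |τ| := hT0.trans_le hτ
  have hL := (tendsto_sum_setIntegral_sq (β₀ := β₀) (γ := γ) hn hdata hvar
    (inv_pos.2 hτ0)).const_mul (2 / δ)
  rw [mul_zero] at hL
  have hcf := Metric.tendsto_nhds.1 (tendsto_charFun_flippedLaw_sub hn hdata hsign hmean hvar
    (τ • (EuclideanSpace.single b 1 - EuclideanSpace.single c 1))) _ hε4
  filter_upwards [eventually_isCondCentredArray hn hdata hmean hvar, hδk, hcf,
    hL.eventually (gt_mem_nhds hε4)] with k hk h1 h2 h3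
  have := (hdata k).isProbabilityMeasure
  obtain ⟨-, hmem, -, -, 𝓗, h𝓗⟩ := hk
  have h4 := h𝓗.integral_prod_cos_sq_le hmem (abs_pos.1 hτ0) hδ
  rw [dist_zero_right] at h2
  have h5 : Real.exp (-(τ ^ 2 * δ / 4)) ≤ Real.exp (-(T ^ 2 * δ / 4)) := by
    have : T ^ 2 ≤ τ ^ 2 := by rw [← sq_abs τ]; gcongr
    gcongr
  have h6 : 0 ≤ prodCosMean (E k) β₀ γ
      (τ • (EuclideanSpace.single b (1 : ℝ) - EuclideanSpace.single c 1)) := by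
    rw [prodCosMean_smul_single_sub_single _ hbc]
    exact integral_nonneg fun ω => Finset.prod_nonneg fun j _ => sq_nonneg _
  have h7 := norm_le_norm_sub_add (charFun (flippedLaw (E k) ((E k).zetaStar β₀ γ))
    (τ • (EuclideanSpace.single b 1 - EuclideanSpace.single c 1)))
    (prodCosMean (E k) β₀ γ (τ • (EuclideanSpace.single b (1 : ℝ) - EuclideanSpace.single c 1)) : ℂ)
  rw [Complex.norm_real, Real.norm_of_nonneg h6, prodCosMean_smul_single_sub_single _ hbc] at h7
  rw [prodCosMean_smul_single_sub_single _ hbc] at h2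
  linarith

/-- The plug-in error is asymptotically negligible. -/
lemma tendsto_charFun_flippedLaw_zetaHat_sub
    (hdata : ∀ k, (E k).DataConditions) (hsign : ∀ k, (E k).SignConditions)
    (hplug : NegligibleNuisance E β₀ γ) (t : EuclideanSpace ℝ (Fin B)) :
    Tendsto (fun k => charFun (flippedLaw (E k) ((E k).zetaHat β₀)) t
      - charFun (flippedLaw (E k) ((E k).zetaStar β₀ γ)) t) atTop (𝓝 0) := by
  rw [Metric.tendsto_nhds]
  intro ε hε
  have hT : 0 ≤ ∑ b, |t b| := Finset.sum_nonneg fun b _ => abs_nonneg _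
  let η : ℝ := ε / (2 * (∑ b, |t b| + 1))
  have hη : 0 < η := by positivity
  have hTη : (∑ b, |t b|) * η < ε / 2 := by
    have h1 : (∑ b, |t b|) * η = (∑ b, |t b|) / (∑ b, |t b| + 1) * (ε / 2) := by
      simp only [η]; field_simp
    have h2 : (∑ b, |t b|) / (∑ b, |t b| + 1) < 1 := by
      rw [div_lt_one (by positivity)]; linarith
    rw [h1]
    have : 0 < ε / 2 := by positivity
    nlinarith
  have hP := (ENNReal.tendsto_toReal ENNReal.zero_ne_top).comp (hplug η hη)
  have hε4 : (0 : ENNReal).toReal < ε / 4 := by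
    rw [ENNReal.toReal_zero]; positivity
  filter_upwards [hP.eventually (gt_mem_nhds hε4)] with k hk
  have := (hdata k).isProbabilityMeasure
  rw [dist_zero_right]
  have h1 := norm_charFun_flippedSum_sub_le (hsign k).measurable_sign
    (fun j => ((hdata k).measurable_zetaStar (β₀ := β₀) (γ := γ) j).const_mul (E k).scale)
    (fun j => ((hdata k).measurable_zetaHat (β₀ := β₀) j).const_mul (E k).scale)
    (SignConditions.ae_abs_sign_le_one (hdata k) (hsign k)) t hη.le
  refine h1.trans_lt ?_
  have h2 : ∀ ω, ∑ j, |(E k).scale * (E k).zetaHat β₀ j ω - (E k).scale * (E k).zetaStar β₀ γ j ω|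
      = |((E k).total : ℝ) ^ (-(1 / 2) : ℝ) *
        (∑ j, |(E k).zetaHat β₀ j ω - (E k).zetaStar β₀ γ j ω|)| := fun ω => by
    rw [abs_mul, abs_of_nonneg (a := ∑ j, _) (Finset.sum_nonneg fun j _ => abs_nonneg _),
      Finset.mul_sum]
    refine Finset.sum_congr rfl fun j _ => ?_
    rw [← mul_sub, abs_mul]
    rfl
  simp only [h2]
  have h3 : (E k).P.real {ω | η < |((E k).total : ℝ) ^ (-(1 / 2) : ℝ) *
        (∑ j, |(E k).zetaHat β₀ j ω - (E k).zetaStar β₀ γ j ω|)|} < ε / 4 := hk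
  linarith

end Limit

/-! ### The rejection probability -/

lemma ceil_add_floor_eq {B : ℕ} {α : ℝ} (hα0 : 0 < α) (hα1 : α < 1) :
    ⌈(1 - α) * (B : ℝ)⌉₊ + ⌊α * (B : ℝ)⌋₊ = B := by
  have hB : (0 : ℝ) ≤ B := Nat.cast_nonneg _
  have h1 := Nat.floor_le (show 0 ≤ α * (B : ℝ) by positivity)
  have h2 := Nat.lt_floor_add_one (α * (B : ℝ))
  have h3 := Nat.le_ceil ((1 - α) * (B : ℝ))
  have h4 := Nat.ceil_lt_add_one (show 0 ≤ (1 - α) * (B : ℝ) by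
    have := sub_pos.2 hα1; positivity)
  have h5 : (⌈(1 - α) * (B : ℝ)⌉₊ : ℝ) + ⌊α * (B : ℝ)⌋₊ < B + 1 := by linarith
  have h6 : (B : ℝ) < (⌈(1 - α) * (B : ℝ)⌉₊ : ℝ) + ⌊α * (B : ℝ)⌋₊ + 1 := by linarith
  have h5' : ⌈(1 - α) * (B : ℝ)⌉₊ + ⌊α * (B : ℝ)⌋₊ < B + 1 := by exact_mod_cast h5
  have h6' : B < ⌈(1 - α) * (B : ℝ)⌉₊ + ⌊α * (B : ℝ)⌋₊ + 1 := by exact_mod_cast h6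
  omega

theorem mainTheorem1 {q B : ℕ} [NeZero B] (E : ℕ → ClusterExperiment.{u} q B)
    (α : ℝ) (hα0 : 0 < α) (hα1 : α < 1)
    (β β₀ : ℝ) (γstar : Fin q → ℝ)
    (hnull : β = β₀)
    (hn : Tendsto (fun k => (E k).total) atTop atTop)
    (hdata : ∀ k, (E k).DataConditions)
    (hsign : ∀ k, (E k).SignConditions)
    (hfull : NonsingularDesign E)
    (hmean : ∀ k, (E k).MeanModel β γstar)
    (hsize : NegligibleClusters E)
    (hlyap : LyapunovCondition E β₀ γstar)
    (hvar : VarianceCondition E β₀ γstar)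
    (hcond : ConditionallyNondegenerate E β₀ γstar)
    (hrate : NuisanceRate E β₀ γstar)
    (hplug : NegligibleNuisance E β₀ γstar) :
    Tendsto (fun k => (E k).P.real ((E k).rejectionEvent β₀ α)) atTop
        (𝓝 ((⌊α * (B : ℝ)⌋₊ : ℝ) / (B : ℝ))) ∧
      (⌊α * (B : ℝ)⌋₊ : ℝ) / (B : ℝ) ≤ α := by
  subst hnull
  have hB : (0 : ℝ) < B := by exact_mod_cast Nat.pos_of_ne_zero (NeZero.ne B)
  refine ⟨?_, by
    rw [div_le_iff₀ hB]
    exact Nat.floor_le (by positivity)⟩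
  have hsum := ceil_add_floor_eq (B := B) hα0 hα1
  have hr1 : 1 ≤ ⌈(1 - α) * (B : ℝ)⌉₊ := Nat.one_le_ceil_iff.2 (by
    have := sub_pos.2 hα1; positivity)
  have hr2 : ⌈(1 - α) * (B : ℝ)⌉₊ ≤ B := by omega
  have hprob := fun k => (hdata k).isProbabilityMeasure
  have hmS : ∀ k, Measurable fun ω => flippedSum ((E k).sign ω) fun j =>
      (E k).scale * (E k).zetaStar β γstar j ω := fun k =>
    measurable_flippedSum (hsign k).measurable_sign fun j =>
      ((hdata k).measurable_zetaStar j).const_mul _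
  have hmH : ∀ k, Measurable fun ω => flippedSum ((E k).sign ω) fun j =>
      (E k).scale * (E k).zetaHat β j ω := fun k =>
    measurable_flippedSum (hsign k).measurable_sign fun j =>
      ((hdata k).measurable_zetaHat j).const_mul _
  let μ : ℕ → ProbabilityMeasure (EuclideanSpace ℝ (Fin B)) := fun k =>
    ⟨flippedLaw (E k) ((E k).zetaHat β), Measure.isProbabilityMeasure_map (hmH k).aemeasurable⟩
  let μ' : ℕ → ProbabilityMeasure (EuclideanSpace ℝ (Fin B)) := fun k =>
    ⟨flippedLaw (E k) ((E k).zetaStar β γstar),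
      Measure.isProbabilityMeasure_map (hmS k).aemeasurable⟩
  obtain ⟨C, hC, hCk⟩ := eventually_sum_integral_sq_le hn hdata hmean hvar
  -- independent signs do not change the second moments of uncorrelated sums
  have htight : ∀ᶠ k in atTop, ∫⁻ x, ‖x‖ₑ ^ 2 ∂(μ' k : Measure (EuclideanSpace ℝ (Fin B)))
      ≤ ENNReal.ofReal (B * C) := by
    filter_upwards [eventually_isCondCentredArray hn hdata hmean hvar, hCk] with k hk hCk1
    obtain ⟨-, hmem, -, -, 𝓗, h𝓗⟩ := hk
    change ∫⁻ x, ‖x‖ₑ ^ 2 ∂((E k).P.map _) ≤ _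
    rw [lintegral_map (by fun_prop) (hmS k)]
    refine (lintegral_norm_flippedSum_sq_le h𝓗 hmem (hsign k).measurable_sign
      (ClusterExperiment.SignConditions.ae_abs_sign_le_one (hdata k) (hsign k))
      (ClusterExperiment.SignConditions.indepFun_zetaStar_sign (hdata k) (hsign k))).trans ?_
    exact ENNReal.ofReal_le_ofReal (by gcongr)
  have hex : ∀ (π : Equiv.Perm (Fin B)) (t : EuclideanSpace ℝ (Fin B)),
      Tendsto (fun k => charFun (μ' k : Measure (EuclideanSpace ℝ (Fin B))) (WithLp.toLp 2 (t ∘ π))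
        - charFun (μ' k : Measure (EuclideanSpace ℝ (Fin B))) t) atTop (𝓝 0) := by
    intro π t
    have h1 := (tendsto_charFun_flippedLaw_sub hn hdata hsign hmean hvar
      (WithLp.toLp 2 (t ∘ π))).sub (tendsto_charFun_flippedLaw_sub hn hdata hsign hmean hvar t)
    rw [sub_zero] at h1
    refine h1.congr fun k => ?_
    rw [prodCosMean_comp_perm, sub_sub_sub_cancel_right]
    rfl
  have hmain := tendsto_measureReal_le_rankBelow μ μ' ENNReal.ofReal_ne_top htight
    (tendsto_charFun_flippedLaw_zetaHat_sub hdata hsign hplug) hex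
    (fun b c hbc ε hε =>
      exists_forall_norm_charFun_flippedLaw_le hn hdata hsign hmean hvar hcond hbc hε) hr2 0
  have hval : ((B : ℝ) - ⌈(1 - α) * (B : ℝ)⌉₊) / B = (⌊α * (B : ℝ)⌋₊ : ℝ) / B := by
    congr 1
    have : (⌈(1 - α) * (B : ℝ)⌉₊ : ℝ) + ⌊α * (B : ℝ)⌋₊ = B := by exact_mod_cast hsum
    linarith
  rw [hval] at hmain
  refine hmain.congr fun k => ?_
  rw [ClusterExperiment.rejectionEvent_eq hr1 hr2]
  exact map_measureReal_apply (hmH k) (measurableSet_le_rankBelow _ _)
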